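/- **Setting.** Fix a finite domain $[q]$, $q\ge 1$. A constraint function of arity $n\ge 1$ is a function $F:[q]^n\to\mathbb C$; write $n_F$ for its arity and $\overline F$ for its entrywise complex conjugate. A set $\mathcal F$ of constraint functions on $[q]$ is *conjugate closed* if $F\in\mathcal F\iff\overline F\in\mathcal F$. A *gadget* with $m$ output and $d$ input dangling edges is a finite bipartite multigraph with at least one vertex, whose two kinds of vertices are *constraint vertices* and *equality vertices*, together with $m+d$ dangling edges (edges with one endpoint), all attached to equality vertices. Each constraint vertex is assigned a constraint function $F$ whose arity is the degree of the vertex, together with a linear order of its incident edges (the inputs of $F$); each equality vertex of degree $k\ge 0$ (dangling edges included) is assigned the $k$-ary equality function $E_k$. Outputs are drawn on the left and inputs on the right, both numbered from top to bottom. Gadgets are considered up to isomorphism respecting all these data. The gadget is *in the context of* $\mathrm{Holant}(\mathcal F\mid\mathcal{EQ})$ if all constraint vertices are assigned functions from $\mathcal F$. It is *planar* if its multigraph has a plane embedding in which the edges at every constraint vertex appear around it in the cyclic order of their labels (clockwise or counterclockwise, independently for each vertex), and the dangling edges reach the outer face in the cyclic order: outputs from top to bottom, then inputs from bottom to top. Let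 $\mathcal P_{\mathcal F}$ be the class of all planar gadgets in the context of $\mathrm{Holant}(\mathcal F\mid\mathcal{EQ})$. **Operations.** If $\mathbf K$ has $d$ inputs and $\mathbf L$ has $d$ outputs, then $\mathbf K\circ\mathbf L$ is obtained by joining the $j$th input of $\mathbf K$ with the $j$th output of $\mathbf L$ for every $j$ and contracting all the edges so created, so that equality vertices connected by such edges become one equality vertex. $\mathbf K\otimes\mathbf L$ is the disjoint union with $\mathbf K$ placed above $\mathbf L$. $\mathbf K^\dagger$ is obtained by exchanging the inputs and outputs of $\mathbf K$ and replacing every $F$ by $\overline F$, keeping the order of the inputs of each constraint function. For a class $\mathcal S$ of gadgets, $\langle\mathcal S\rangle_{\circ,\otimes,\dagger}$ denotes its closure under these three operations. **Generators.** $\mathbf E^{m,d}$ is the gadget consisting of a single equality vertex with $m$ output and $d$ input dangling edges. $\mathbf F^{n_F,0}$ is the gadget with one constraint vertex assigned $F$ and $n_F$ equality vertices of degree $2$, the $i$th of which is joined to the $i$th input of $F$ and carries the $i$th output dangling edge. **Theorem.** For every conjugate closed set $\mathcal F$ of constraint functions, $$\mathcal P_{\mathcal F}=\big\langle \mathbf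 E^{1,0},\ \mathbf E^{1,2},\ \{\mathbf F^{n_F,0} : F\in\mathcal F\}\big\rangle_{\circ,\otimes,\dagger}.$$ -/

import Mathlib

/-- A constraint function (signature) with domain `[q]`: a function `[q]ⁿ → ℂ` of some arity
`n ≥ 1`. -/
structure ConstraintFunction (q : ℕ) where
  arity : ℕ
  arity_pos : 1 ≤ arity
  val : (Fin arity → Fin q) → ℂ

/-- The entrywise complex conjugate of a constraint function. -/
def ConstraintFunction.conj {q : ℕ} (F : ConstraintFunction q) : ConstraintFunction q where
  arity := F.arity
  arity_pos := F.arity_pos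
  val := fun x => (starRingEnd ℂ) (F.val x)

/-- A set of constraint functions is conjugate closed if `F ∈ 𝓕 ↔ F.conj ∈ 𝓕`. -/
def ConjugateClosed {q : ℕ} (𝓕 : Set (ConstraintFunction q)) : Prop :=
  ∀ F : ConstraintFunction q, F ∈ 𝓕 ↔ F.conj ∈ 𝓕

/-- A gadget of a bipartite Holant problem `Holant(· | EQ)` over the domain `[q]`, with `m` output
and `d` input dangling edges.  The underlying multigraph is finite, has at least one vertex, and is
bipartite with parts `C` (constraint vertices) and `E` (equality vertices).

* The edges at a constraint vertex `c` are ordered; they are the pairs `(c, i)` with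
  `i < arity (sig c)`.  The edge `(c, i)` carries the `i`-th input variable of `sig c`, and its other
  end is the equality vertex `inc c i`.  By bipartiteness every internal edge arises exactly once
  in this way.  Parallel edges are allowed.
* Every dangling edge is attached to an equality vertex.  The `i`-th output from the top is
  attached to `out i`, the `j`-th input from the top is attached to `inp j`.  Outputs are drawn
  on the left and inputs on the right, so the counterclockwise order of all dangling edges is
  `out 0, …, out (m-1), inp (d-1), …, inp 0`.
* An equality vertex of degree `k` (dangling edges included) carries the `k`-ary equality
  signature. This is determined by the multigraph and symmetric, so it is not recorded. -/
structure Gadget (q m d : ℕ) where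
  E : Type
  C : Type
  finite_E : Finite E
  finite_C : Finite C
  nonempty_E : Nonempty E
  sig : C → ConstraintFunction q
  inc : (c : C) → Fin (sig c).arity → E
  out : Fin m → E
  inp : Fin d → E

namespace Gadget

/-- Isomorphism of gadgets: isomorphism of the underlying multigraphs respecting the two parts, the
signatures, the order of the inputs of each signature, and the order of the dangling edges. -/
structure Iso {q m d : ℕ} (G H : Gadget q m d) where
  onE : G.E ≃ H.E
  onC : G.C ≃ H.C
  sig_eq : ∀ c, H.sig (onC c) = G.sig c
  inc_eq : ∀ c i,
    H.inc (onC c) (Fin.cast (congrArg ConstraintFunction.arity (sig_eq c)).symm i)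
      = onE (G.inc c i)
  out_eq : ∀ i, H.out i = onE (G.out i)
  inp_eq : ∀ j, H.inp j = onE (G.inp j)

/-! ### The elementary gadgets -/

/-- `E^{m,d}`: a single equality vertex with `m` output and `d` input dangling edges. -/
def eqGadget (q m d : ℕ) : Gadget q m d where
  E := Unit
  C := Empty
  finite_E := inferInstance
  finite_C := inferInstance
  nonempty_E := inferInstance
  sig := fun c => c.elim
  inc := fun c => c.elim
  out := fun _ => ()
  inp := fun _ => ()

/-- `F^{n,0}` for a constraint function `F` of arity `n`: one constraint vertex assigned `F`, whose
`i`-th edge goes to a binary equality vertex carrying the `i`-th output dangling edge. -/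
def sigGadget {q : ℕ} (F : ConstraintFunction q) : Gadget q F.arity 0 where
  E := Fin F.arity
  C := Unit
  finite_E := inferInstance
  finite_C := inferInstance
  nonempty_E := ⟨⟨0, F.arity_pos⟩⟩
  sig := fun _ => F
  inc := fun _ i => i
  out := fun i => i
  inp := fun j => j.elim0

/-! ### The operations -/

/-- The `j`-th input dangling edge of `K` is joined to the `j`-th output dangling edge of `L`. -/
inductive Glue {q m d w : ℕ} (K : Gadget q m d) (L : Gadget q d w) : K.E ⊕ L.E → K.E ⊕ L.E → Prop
  | glue (j : Fin d) : Glue K L (Sum.inl (K.inp j)) (Sum.inr (L.out j))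

/-- Composition `K ∘ L`: place `L` to the right of `K`, join the `j`-th input of `K` to the `j`-th
output of `L`, and contract all the resulting edges between equality vertices, so that equality
vertices connected by such edges become a single equality vertex. -/
def comp {q m d w : ℕ} (K : Gadget q m d) (L : Gadget q d w) : Gadget q m w where
  E := Quot (Glue K L)
  C := K.C ⊕ L.C
  finite_E := by
    have := K.finite_E
    have := L.finite_E
    infer_instance
  finite_C := by
    have := K.finite_C
    have := L.finite_C
    infer_instance
  nonempty_E := K.nonempty_E.map fun v => Quot.mk _ (Sum.inl v)
  sig := Sum.elim K.sig L.sig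
  inc := fun c => match c with
    | Sum.inl c => fun i => Quot.mk _ (Sum.inl (K.inc c i))
    | Sum.inr c => fun i => Quot.mk _ (Sum.inr (L.inc c i))
  out := fun i => Quot.mk _ (Sum.inl (K.out i))
  inp := fun j => Quot.mk _ (Sum.inr (L.inp j))

/-- Tensor product `K ⊗ L`: the disjoint union, with `K` placed above `L`. -/
def tensor {q m₁ d₁ m₂ d₂ : ℕ} (K : Gadget q m₁ d₁) (L : Gadget q m₂ d₂) :
    Gadget q (m₁ + m₂) (d₁ + d₂) where
  E := K.E ⊕ L.E
  C := K.C ⊕ L.C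
  finite_E := by
    have := K.finite_E
    have := L.finite_E
    infer_instance
  finite_C := by
    have := K.finite_C
    have := L.finite_C
    infer_instance
  nonempty_E := K.nonempty_E.map Sum.inl
  sig := Sum.elim K.sig L.sig
  inc := fun c => match c with
    | Sum.inl c => fun i => Sum.inl (K.inc c i)
    | Sum.inr c => fun i => Sum.inr (L.inc c i)
  out := Fin.append (fun i => Sum.inl (K.out i)) (fun i => Sum.inr (L.out i))
  inp := Fin.append (fun j => Sum.inl (K.inp j)) (fun j => Sum.inr (L.inp j))

/-- Conjugate transpose `K†`: reflect horizontally (outputs become inputs and vice versa) and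
conjugate every signature, keeping the order of the inputs of each signature. -/
def dagger {q m d : ℕ} (K : Gadget q m d) : Gadget q d m where
  E := K.E
  C := K.C
  finite_E := K.finite_E
  finite_C := K.finite_C
  nonempty_E := K.nonempty_E
  sig := fun c => (K.sig c).conj
  inc := fun c i => K.inc c i
  out := K.inp
  inp := K.out

/-! ### Planarity

An embedding is described combinatorially, by a rotation system of genus zero.  The dangling edges
are extended to one additional vertex, "infinity", which sits in the outer face; it is treated
like a constraint vertex whose edges are the dangling edges.  The resulting graph is bipartite,
and a rotation system on it is a pair of permutations of its edges, whose cycles are the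
(clockwise) rotations around the constraint vertices and infinity, and around the equality vertices,
respectively. -/

/-- All edges: the internal edges, the output dangling edges and the input dangling edges. -/
abbrev Edge {q m d : ℕ} (K : Gadget q m d) : Type :=
  (Σ c : K.C, Fin (K.sig c).arity) ⊕ (Fin m ⊕ Fin d)

/-- The equality vertex incident to an edge. -/
def endE {q m d : ℕ} (K : Gadget q m d) : K.Edge → K.E :=
  Sum.elim (fun x => K.inc x.1 x.2) (Sum.elim K.out K.inp)

/-- The cyclic order `out 0 → ⋯ → out (m-1) → inp (d-1) → ⋯ → inp 0 → out 0` of the dangling edges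
(counterclockwise around the gadget, that is, clockwise around infinity). -/
def danglingRotation (m d : ℕ) : Equiv.Perm (Fin m ⊕ Fin d) :=
  ((Equiv.sumCongr (Equiv.refl (Fin m)) Fin.revPerm).trans finSumFinEquiv).symm.permCongr
    (finRotate (m + d))

/-- The rotation around the constraint vertices and infinity.  The inputs of the signature at `c`
are in cyclic order around `c`: clockwise if `o c = true`, counterclockwise if `o c = false`.
The dangling edges are in cyclic order around infinity. -/
def rotC {q m d : ℕ} (K : Gadget q m d) (o : K.C → Bool) : Equiv.Perm K.Edge :=
  Equiv.Perm.sumCongr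
    (Equiv.Perm.sigmaCongrRight fun c =>
      if o c then finRotate (K.sig c).arity else (finRotate (K.sig c).arity)⁻¹)
    (danglingRotation m d)

/-- The number of cycles of a permutation, fixed points included. -/
noncomputable def numCycles {X : Type} (σ : Equiv.Perm X) : ℕ :=
  Nat.card (Quotient (Equiv.Perm.SameCycle.setoid σ))

/-- The number of orbits of the group generated by two permutations. -/
noncomputable def numOrbits {X : Type} (σ τ : Equiv.Perm X) : ℕ :=
  Nat.card (MulAction.orbitRel.Quotient (Subgroup.closure {σ, τ} : Subgroup (Equiv.Perm X)) X)

/-- A bipartite rotation system on a finite set `X` of edges, `σ` and `τ` being the rotations around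
the vertices of the two parts, is planar if every component is embedded in the sphere.  The cycles
of `τ * σ` are the faces, so this is Euler's formula
`#vertices - #edges + #faces = 2 * #components`, where isolated vertices are left out. -/
def IsPlanarRotation {X : Type} (σ τ : Equiv.Perm X) : Prop :=
  numCycles σ + numCycles τ + numCycles (τ * σ) = Nat.card X + 2 * numOrbits σ τ

/-- A gadget is planar if its underlying multigraph has a plane embedding in which the inputs of
every constraint vertex are in cyclic order (clockwise or counterclockwise) around it, and the
dangling edges lie in cyclic order in the outer face. -/
def IsPlanar {q m d : ℕ} (K : Gadget q m d) : Prop :=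
  ∃ (o : K.C → Bool) (τ : Equiv.Perm K.Edge),
    (∀ x y, τ.SameCycle x y ↔ K.endE x = K.endE y) ∧ IsPlanarRotation (K.rotC o) τ

end Gadget

/-- A family of gadgets: for all `m` and `d`, a set of gadgets with `m` outputs and `d` inputs. -/
abbrev GadgetFamily (q : ℕ) : Type 1 := ∀ m d : ℕ, Set (Gadget q m d)

/-- The family `P_𝓕` of all planar gadgets in the context of `Holant(𝓕 | EQ)`. -/
def planarGadgets {q : ℕ} (𝓕 : Set (ConstraintFunction q)) : GadgetFamily q :=
  fun _ _ => {K | (∀ c, K.sig c ∈ 𝓕) ∧ K.IsPlanar}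

/-- The generators `E^{1,0}`, `E^{1,2}` and `F^{n,0}` for `F ∈ 𝓕`, where `n` is the arity of `F`. -/
inductive IsGenerator {q : ℕ} (𝓕 : Set (ConstraintFunction q)) :
    ∀ m d : ℕ, Gadget q m d → Prop
  | e10 : IsGenerator 𝓕 1 0 (Gadget.eqGadget q 1 0)
  | e12 : IsGenerator 𝓕 1 2 (Gadget.eqGadget q 1 2)
  | sig (F : ConstraintFunction q) (hF : F ∈ 𝓕) : IsGenerator 𝓕 F.arity 0 (Gadget.sigGadget F)

/-- The family of generators. -/
def generators {q : ℕ} (𝓕 : Set (ConstraintFunction q)) : GadgetFamily q :=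
  fun m d => {K | IsGenerator 𝓕 m d K}

/-- Membership in the closure of a family of gadgets under composition, tensor product and
conjugate transpose.  Gadgets are considered up to isomorphism. -/
inductive InClosure {q : ℕ} (S : GadgetFamily q) : ∀ m d : ℕ, Gadget q m d → Prop
  | of {m d : ℕ} {K : Gadget q m d} : K ∈ S m d → InClosure S m d K
  | comp {m d w : ℕ} {K : Gadget q m d} {L : Gadget q d w} :
      InClosure S m d K → InClosure S d w L → InClosure S m w (K.comp L)
  | tensor {m₁ d₁ m₂ d₂ : ℕ} {K : Gadget q m₁ d₁} {L : Gadget q m₂ d₂} :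
      InClosure S m₁ d₁ K → InClosure S m₂ d₂ L →
        InClosure S (m₁ + m₂) (d₁ + d₂) (K.tensor L)
  | dagger {m d : ℕ} {K : Gadget q m d} : InClosure S m d K → InClosure S d m K.dagger
  | iso {m d : ℕ} {K L : Gadget q m d} : K.Iso L → InClosure S m d K → InClosure S m d L

/-- The closure of a family of gadgets under composition, tensor product and conjugate transpose. -/
def gadgetClosure {q : ℕ} (S : GadgetFamily q) : GadgetFamily q :=
  fun m d => {K | InClosure S m d K}

/-! Planarity is Euler's formula for a pair of permutations `σ`, `τ` of the edges: `σ` rotates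
around the constraint vertices and infinity, `τ` around the equality vertices, and the cycles of `τ
* σ` are the faces. All topology reduces to one fact: multiplying by a transposition `swap a b`
joins the cycles of `a` and `b` if they differ and cuts their common cycle otherwise. Counting
cycles shows that the genus is never negative (`numClasses_add_le`), that splitting a vertex keeps a
system planar (`IsPlanarRotation.split`), and that merging two vertices keeps it planar if they
share a face or lie in different components (`IsPlanarRotation.merge`,
`IsPlanarRotation.merge_left_mul`).

Generated gadgets are planar because the three operations are such surgeries. The dangling edges are
kept as a list up to rotation (`CyclicallyPlanar`). A tensor product merges the infinities of two
disjoint systems (`CyclicallyPlanar.union`). A composition does this too and then contracts pairs of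
neighbouring dangling edges, innermost pair first (`CyclicallyPlanar.contract_list`). The dagger is
a mirror image (`CyclicallyPlanar.reverse`).

Conversely, caps `E^{0,2}` bend outputs into inputs and back, so it is enough to generate planar
gadgets all of whose dangling edges are outputs, and these may be rotated cyclically. Induct on the
number of constraint vertices. Some constraint vertex shares a face with infinity or lies in another
component (`IsPlanarPartition.exists_merge`); merging it into infinity turns its edges into
consecutive dangling edges of a planar gadget with one constraint vertex less
(`CyclicallyPlanar.exists_remove`). That gadget is generated, and composing it with a bent `F^{n,0}`
restores the vertex (`Generated.attach`). A vertex with the opposite orientation needs the inputs of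
`F` in reverse order; the dagger of the generator for the conjugate of `F` supplies it, which is
where conjugate closure enters.

Without constraint vertices the gadget is a noncrossing partition, possibly with empty blocks. If
there are at least two dangling edges, Euler's formula yields a singleton block or two neighbouring
edges in one block (`CyclicallyPlanar.exists_reduction`), and one removes a block or an edge. -/

/-! ### Counting the classes of an equivalence relation -/

/-- The number of classes of an equivalence relation. -/
noncomputable def numClasses {X : Type} (r : Setoid X) : ℕ := Nat.card (Quotient r)

/-- The equivalence relation obtained from `r` by merging the classes of `a` and `b`. -/
def mergeSetoid {X : Type} (r : Setoid X) (a b : X) : Setoid X where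
  r x y := r x y ∨ (r x a ∧ r b y) ∨ (r x b ∧ r a y)
  iseqv := by
    refine ⟨fun x => Or.inl (r.refl x), ?_, ?_⟩
    · rintro x y (h | ⟨h, k⟩ | ⟨h, k⟩)
      · exact Or.inl (r.symm h)
      · exact Or.inr (Or.inr ⟨r.symm k, r.symm h⟩)
      · exact Or.inr (Or.inl ⟨r.symm k, r.symm h⟩)
    · rintro x y z (h | ⟨h, k⟩ | ⟨h, k⟩) (h' | ⟨h', k'⟩ | ⟨h', k'⟩)
      · exact Or.inl (r.trans h h')
      · exact Or.inr (Or.inl ⟨r.trans h h', k'⟩)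
      · exact Or.inr (Or.inr ⟨r.trans h h', k'⟩)
      · exact Or.inr (Or.inl ⟨h, r.trans k h'⟩)
      · exact Or.inr (Or.inl ⟨h, k'⟩)
      · exact Or.inl (r.trans h k')
      · exact Or.inr (Or.inr ⟨h, r.trans k h'⟩)
      · exact Or.inl (r.trans h k')
      · exact Or.inr (Or.inr ⟨h, k'⟩)

section Setoids

variable {X : Type} {r s : Setoid X} {a b : X}

theorem mergeSetoid_rel {x y : X} :
    mergeSetoid r a b x y ↔ r x y ∨ (r x a ∧ r b y) ∨ (r x b ∧ r a y) := Iff.rfl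

theorem le_mergeSetoid : r ≤ mergeSetoid r a b := fun _ _ h => Or.inl h

theorem mergeSetoid_self : mergeSetoid r a b a b := Or.inr (Or.inl ⟨r.refl a, r.refl b⟩)

theorem mergeSetoid_le (h : r ≤ s) (hab : s a b) : mergeSetoid r a b ≤ s := by
  rintro x y (k | ⟨k, l⟩ | ⟨k, l⟩)
  · exact h k
  · exact s.trans (h k) (s.trans hab (h l))
  · exact s.trans (h k) (s.trans (s.symm hab) (h l))

theorem mergeSetoid_eq_self (hab : r a b) : mergeSetoid r a b = r :=
  le_antisymm (mergeSetoid_le le_rfl hab) le_mergeSetoid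

theorem mergeSetoid_congr {c d : X} (hac : r a c) (hbd : r b d) :
    mergeSetoid r a b = mergeSetoid r c d := by
  apply le_antisymm
  · refine mergeSetoid_le le_mergeSetoid ?_
    exact Or.inr (Or.inl ⟨hac, r.symm hbd⟩)
  · refine mergeSetoid_le le_mergeSetoid ?_
    exact Or.inr (Or.inl ⟨r.symm hac, hbd⟩)

theorem sup_mergeSetoid : s ⊔ mergeSetoid r a b = mergeSetoid (s ⊔ r) a b := by
  apply le_antisymm
  · refine sup_le (le_sup_left.trans le_mergeSetoid)
      (mergeSetoid_le (le_sup_right.trans le_mergeSetoid) mergeSetoid_self)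
  · refine mergeSetoid_le (sup_le_sup le_rfl le_mergeSetoid) ?_
    exact (le_sup_right : mergeSetoid r a b ≤ s ⊔ mergeSetoid r a b) mergeSetoid_self

variable [Finite X]

/-- The class of `b` is absorbed by that of `a`, so the merged classes correspond to the old classes
other than that of `b`. -/
theorem numClasses_mergeSetoid (hab : ¬ r a b) :
    numClasses (mergeSetoid r a b) + 1 = numClasses r := by
  classical
  let q₀ : Quotient r := Quotient.mk r b
  have e : {q : Quotient r // q ≠ q₀} ≃ Quotient (mergeSetoid r a b) := by
    refine Equiv.ofBijective (fun q => Quotient.map' (s₁ := r) (s₂ := mergeSetoid r a b) id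
      (fun x y h => Or.inl h) q.1) ⟨?_, ?_⟩
    · rintro ⟨⟨x⟩, hx⟩ ⟨⟨y⟩, hy⟩ h
      have hx' : ¬ r x b := fun h => hx (Quotient.sound h)
      have hy' : ¬ r y b := fun h => hy (Quotient.sound h)
      have h' : mergeSetoid r a b x y := Quotient.exact h
      rcases h' with k | ⟨k, l⟩ | ⟨k, l⟩
      · exact Subtype.ext (Quotient.sound k)
      · exact absurd (r.symm l) hy'
      · exact absurd k hx'
    · rintro ⟨x⟩
      by_cases hx : r x b
      · refine ⟨⟨Quotient.mk r a, fun h => hab (Quotient.exact h)⟩, ?_⟩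
        exact Quotient.sound (Or.inr (Or.inl ⟨r.refl a, r.symm hx⟩))
      · exact ⟨⟨Quotient.mk r x, fun h => hx (Quotient.exact h)⟩, rfl⟩
  rw [numClasses, numClasses, ← Nat.card_congr e, ← Nat.card_congr (Equiv.optionSubtypeNe q₀),
    Finite.card_option]

theorem numClasses_mergeSetoid_le : numClasses r ≤ numClasses (mergeSetoid r a b) + 1 := by
  by_cases hab : r a b
  · rw [mergeSetoid_eq_self hab]; omega
  · rw [numClasses_mergeSetoid hab]

theorem numClasses_anti (h : r ≤ s) : numClasses s ≤ numClasses r :=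
  Nat.card_le_card_of_surjective (Quotient.map' (s₁ := r) (s₂ := s) id fun _ _ k => h k) (by
    rintro ⟨x⟩
    exact ⟨Quotient.mk r x, rfl⟩)

theorem eq_of_le_of_numClasses_le (h : r ≤ s) (hn : numClasses r ≤ numClasses s) : r = s := by
  let f : Quotient r → Quotient s := Quotient.map' (s₁ := r) (s₂ := s) id fun _ _ k => h k
  have hs : Function.Surjective f := by
    rintro ⟨x⟩
    exact ⟨Quotient.mk r x, rfl⟩
  have hf : Function.Bijective f :=
    (Nat.bijective_iff_surjective_and_card f).2 ⟨hs, le_antisymm hn (numClasses_anti h)⟩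
  refine le_antisymm h fun {x y} hxy => ?_
  exact Quotient.exact (hf.1 (a₁ := Quotient.mk r x) (a₂ := Quotient.mk r y) (Quotient.sound hxy))

omit [Finite X] in
theorem numClasses_of_ker {Y : Type} (f : X → Y) (hf : Function.Surjective f)
    (h : ∀ x y, r x y ↔ f x = f y) : numClasses r = Nat.card Y := by
  refine Nat.card_congr (Equiv.ofBijective
    (fun q : Quotient r => Quotient.lift f (fun x y k => (h x y).1 k) q) ⟨?_, ?_⟩)
  · rintro ⟨x⟩ ⟨y⟩ k
    exact Quotient.sound ((h x y).2 k)
  · intro y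
    obtain ⟨x, rfl⟩ := hf y
    exact ⟨Quotient.mk r x, rfl⟩

end Setoids

namespace Gadget

open Equiv

/-! ### Cycles of a permutation multiplied by a transposition -/

/-- The partition into the cycles of a permutation. -/
abbrev cycleSetoid {X : Type} (σ : Perm X) : Setoid X := Perm.SameCycle.setoid σ

section Cycles

variable {X : Type} {σ τ π : Perm X} {a b : X}

theorem cycleSetoid_inv : cycleSetoid π⁻¹ = cycleSetoid π := by
  ext x y
  exact Perm.sameCycle_inv

theorem cycleSetoid_apply (x : X) : cycleSetoid π x (π x) := ⟨1, by simp⟩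

theorem cycleSetoid_le {r : Setoid X} (h : ∀ x, r x (π x)) : cycleSetoid π ≤ r := by
  have hpow : ∀ (n : ℕ) x, r x ((π ^ n) x) := by
    intro n
    induction n with
    | zero => exact fun x => r.refl x
    | succ n ih => exact fun x => r.trans (h x) (by simpa [pow_succ] using ih (π x))
  rintro x y ⟨i, rfl⟩
  obtain ⟨n, rfl | rfl⟩ := i.eq_nat_or_neg
  · simpa using hpow n x
  · have := hpow n ((π ^ (-(n : ℤ))) x)
    refine r.symm ?_
    simpa using this

/-- Components become a join of partitions, so the effect of a surgery on them can be computed in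
the lattice of equivalence relations. -/
theorem numOrbits_eq : numOrbits σ τ = numClasses (cycleSetoid σ ⊔ cycleSetoid τ) := by
  have : MulAction.orbitRel (Subgroup.closure {σ, τ} : Subgroup (Perm X)) X
      = cycleSetoid σ ⊔ cycleSetoid τ := by
    apply le_antisymm
    · have key : ∀ g ∈ Subgroup.closure {σ, τ}, ∀ x, (cycleSetoid σ ⊔ cycleSetoid τ) (g x) x := by
        intro g hg
        induction hg using Subgroup.closure_induction with
        | mem g hg =>
          intro x
          rcases hg with rfl | rfl
          · exact (le_sup_left : cycleSetoid g ≤ _) (Setoid.symm' _ (cycleSetoid_apply x))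
          · exact (le_sup_right : cycleSetoid g ≤ _) (Setoid.symm' _ (cycleSetoid_apply x))
        | one => exact fun x => Setoid.refl' _ x
        | mul g h _ _ hg hh => exact fun x => Setoid.trans' _ (hg (h x)) (hh x)
        | inv g _ hg =>
          intro x
          have := hg (g⁻¹ x)
          exact Setoid.symm' _ (by simpa using this)
      rintro x y ⟨⟨g, hg⟩, rfl⟩
      exact key g hg y
    · refine sup_le (cycleSetoid_le fun x => ?_) (cycleSetoid_le fun x => ?_)
      · exact Setoid.symm' _ ⟨⟨σ, Subgroup.subset_closure (by simp)⟩, rfl⟩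
      · exact Setoid.symm' _ ⟨⟨τ, Subgroup.subset_closure (by simp)⟩, rfl⟩
  rw [numOrbits, numClasses, MulAction.orbitRel.Quotient, this]

theorem cycleSetoid_swap_mul_le [DecidableEq X] :
    cycleSetoid (swap a b * π) ≤ mergeSetoid (cycleSetoid π) a b := by
  refine cycleSetoid_le fun x => ?_
  have h := cycleSetoid_apply (π := π) x
  simp only [Perm.mul_apply]
  by_cases h1 : π x = a
  · rw [h1, swap_apply_left]
    rw [h1] at h
    exact Or.inr (Or.inl ⟨h, Setoid.refl' _ _⟩)
  · by_cases h2 : π x = b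
    · rw [h2, swap_apply_right]
      rw [h2] at h
      exact Or.inr (Or.inr ⟨h, Setoid.refl' _ _⟩)
    · rw [swap_apply_of_ne_of_ne h1 h2]
      exact Or.inl h

/-- The transposition is its own inverse, so the one-sided inclusion `cycleSetoid_swap_mul_le`
applies in both directions. -/
theorem mergeSetoid_cycleSetoid_swap_mul [DecidableEq X] :
    mergeSetoid (cycleSetoid (swap a b * π)) a b = mergeSetoid (cycleSetoid π) a b := by
  apply le_antisymm
  · exact mergeSetoid_le cycleSetoid_swap_mul_le mergeSetoid_self
  · refine mergeSetoid_le ?_ mergeSetoid_self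
    have := cycleSetoid_swap_mul_le (π := swap a b * π) (a := a) (b := b)
    rwa [← mul_assoc, swap_mul_self, one_mul] at this

variable [Finite X]

omit [Finite X] in
theorem sign_eq_numClasses [DecidableEq X] [Fintype X] (π : Perm X) :
    Perm.sign π = (-1) ^ (Fintype.card X + numClasses (cycleSetoid π)) := by
  -- The cycle type omits fixed points, so each fixed point stands for its own class, and every
  -- other point for its nontrivial cycle.
  let f : X → Perm X ⊕ X := fun x => if π x = x then Sum.inr x else Sum.inl (π.cycleOf x)
  let T : Finset (Perm X ⊕ X) := π.cycleFactorsFinset.disjSum (π.supportᶜ)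
  have hfT : ∀ x, f x ∈ T := by
    intro x
    by_cases h : π x = x
    · simp [f, T, h]
    · simp [f, T, h, Perm.cycleOf_mem_cycleFactorsFinset_iff]
  have h1 : numClasses (cycleSetoid π) = Nat.card T := by
    refine numClasses_of_ker (fun x => ⟨f x, hfT x⟩) ?_ ?_
    · rintro ⟨g | x, hg⟩
      · have hg' : g ∈ π.cycleFactorsFinset := by simpa [T] using hg
        obtain ⟨hc, hs⟩ := Perm.mem_cycleFactorsFinset_iff.1 hg'
        obtain ⟨x, hx⟩ := hc.nonempty_support
        refine ⟨x, Subtype.ext ?_⟩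
        have : π x ≠ x := by
          rw [← hs x hx]
          exact Perm.mem_support.1 hx
        simp only [f, if_neg this]
        exact congrArg _ (Perm.cycle_is_cycleOf hx hg').symm
      · have : π x = x := by simpa [T] using hg
        exact ⟨x, Subtype.ext (by simp [f, this])⟩
    · intro x y
      simp only [Subtype.mk.injEq, f]
      constructor
      · intro h
        by_cases hx : π x = x
        · have : x = y := Perm.SameCycle.eq_of_left h hx
          rw [this]
        · have hy : π y ≠ y := fun hy => hx ((Perm.SameCycle.apply_eq_self_iff h).2 hy)
          rw [if_neg hx, if_neg hy, Perm.SameCycle.cycleOf_eq h]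
      · intro h
        split_ifs at h with hx hy hy
        · cases h; exact Setoid.refl' _ _
        · have h2 := Sum.inl_injective h
          have hmem : y ∈ (π.cycleOf x).support := by
            rw [h2, Perm.mem_support_cycleOf_iff]
            exact ⟨Perm.SameCycle.refl _ _, Perm.mem_support.2 hy⟩
          exact (Perm.mem_support_cycleOf_iff.1 hmem).1
  have h2 : Nat.card T = Multiset.card π.cycleType + (Fintype.card X - π.cycleType.sum) := by
    rw [Nat.card_eq_fintype_card, Fintype.card_coe, Finset.card_disjSum, Finset.card_compl,
      Perm.sum_cycleType, Perm.cycleType_def, Multiset.card_map]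
    rfl
  have h3 : π.cycleType.sum ≤ Fintype.card X := by
    rw [Perm.sum_cycleType]
    exact Finset.card_le_univ _
  rw [Perm.sign_of_cycleType, h1, h2]
  obtain ⟨k, hk⟩ := Nat.exists_eq_add_of_le h3
  rw [hk, Nat.add_sub_cancel_left,
    show π.cycleType.sum + k + (Multiset.card π.cycleType + k)
      = (π.cycleType.sum + Multiset.card π.cycleType) + 2 * k by ring, pow_add _ _ (2 * k), pow_mul]
  simp

variable [DecidableEq X]

theorem numClasses_swap_mul_parity (hab : a ≠ b) :
    Even (numClasses (cycleSetoid (swap a b * π)) + numClasses (cycleSetoid π) + 1) := by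
  classical
  have := Fintype.ofFinite X
  have h := sign_eq_numClasses (swap a b * π)
  rw [Perm.sign_mul, Perm.sign_swap hab, sign_eq_numClasses π] at h
  by_contra hc
  rw [Nat.not_even_iff_odd] at hc
  set u := numClasses (cycleSetoid (swap a b * π))
  set v := numClasses (cycleSetoid π)
  have h2 : ((-1 : ℤˣ)) ^ (Fintype.card X + u) * (-1) ^ (Fintype.card X + v) * (-1) = 1 := by
    rw [← h, mul_assoc (-1 : ℤˣ), ← pow_add, ← two_mul, pow_mul]
    simp
  rw [← pow_add, ← pow_succ] at h2
  have h3 : Odd (Fintype.card X + u + (Fintype.card X + v) + 1) := by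
    rcases hc with ⟨k, hk⟩
    exact ⟨Fintype.card X + k, by omega⟩
  rw [h3.neg_one_pow] at h2
  exact absurd h2 (by decide)

/-- A transposition merges two different cycles. -/
theorem cycleSetoid_swap_mul_of_not (hab : ¬ cycleSetoid π a b) :
    cycleSetoid (swap a b * π) = mergeSetoid (cycleSetoid π) a b := by
  have hne : a ≠ b := fun h => hab (h ▸ Setoid.refl' _ _)
  -- Refinement alone would still allow the number of cycles to stay the same; the sign of the
  -- transposition excludes that.
  refine eq_of_le_of_numClasses_le cycleSetoid_swap_mul_le ?_
  have h1 := numClasses_mergeSetoid hab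
  have h2 := numClasses_mergeSetoid_le (r := cycleSetoid (swap a b * π)) (a := a) (b := b)
  rw [mergeSetoid_cycleSetoid_swap_mul] at h2
  obtain ⟨k, hk⟩ := numClasses_swap_mul_parity (π := π) hne
  omega

theorem numClasses_swap_mul_of_not (hab : ¬ cycleSetoid π a b) :
    numClasses (cycleSetoid (swap a b * π)) + 1 = numClasses (cycleSetoid π) := by
  rw [cycleSetoid_swap_mul_of_not hab, numClasses_mergeSetoid hab]

/-- A transposition splits a cycle. -/
theorem not_cycleSetoid_swap_mul (hne : a ≠ b) (hab : cycleSetoid π a b) :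
    ¬ cycleSetoid (swap a b * π) a b := by
  intro h
  -- If `a` and `b` stayed together, both cycle partitions would coincide, against the parity of the
  -- number of cycles.
  have h1 := mergeSetoid_cycleSetoid_swap_mul (π := π) (a := a) (b := b)
  rw [mergeSetoid_eq_self hab, mergeSetoid_eq_self h] at h1
  obtain ⟨k, hk⟩ := numClasses_swap_mul_parity (π := π) hne
  rw [h1] at hk
  omega

omit [Finite X] in
theorem cycleSetoid_eq_of_split (hab : cycleSetoid π a b) :
    cycleSetoid π = mergeSetoid (cycleSetoid (swap a b * π)) a b := by
  rw [mergeSetoid_cycleSetoid_swap_mul, mergeSetoid_eq_self hab]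

theorem numClasses_swap_mul (hne : a ≠ b) (hab : cycleSetoid π a b) :
    numClasses (cycleSetoid (swap a b * π)) = numClasses (cycleSetoid π) + 1 := by
  rw [cycleSetoid_eq_of_split hab, numClasses_mergeSetoid (not_cycleSetoid_swap_mul hne hab)]

end Cycles

/-! ### Planar rotations -/

section Planar

variable {X : Type} {σ τ π : Perm X} {a b : X}

/-- The partition into the orbits of two permutations. -/
abbrev orbitSetoid (σ τ : Perm X) : Setoid X := cycleSetoid σ ⊔ cycleSetoid τ

theorem isPlanarRotation_iff : IsPlanarRotation σ τ ↔
    numClasses (cycleSetoid σ) + numClasses (cycleSetoid τ) + numClasses (cycleSetoid (τ * σ))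
      = Nat.card X + 2 * numClasses (orbitSetoid σ τ) := by
  rw [IsPlanarRotation, numOrbits_eq]
  rfl

theorem cycleSetoid_mul_le : cycleSetoid (τ * σ) ≤ orbitSetoid σ τ :=
  cycleSetoid_le fun x => Setoid.trans' _
    ((le_sup_left : cycleSetoid σ ≤ orbitSetoid σ τ) (cycleSetoid_apply x))
    ((le_sup_right : cycleSetoid τ ≤ orbitSetoid σ τ) (cycleSetoid_apply (σ x)))

theorem numClasses_conj (g : Perm X) :
    numClasses (cycleSetoid (g * π * g⁻¹)) = numClasses (cycleSetoid π) := by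
  refine Nat.card_congr (Quotient.congr g.symm fun x y => ?_)
  exact Perm.sameCycle_conj

theorem numClasses_mul_comm :
    numClasses (cycleSetoid (σ * τ)) = numClasses (cycleSetoid (τ * σ)) := by
  rw [← numClasses_conj (π := σ * τ) τ]
  congr 2
  group

theorem IsPlanarRotation.symm (h : IsPlanarRotation σ τ) : IsPlanarRotation τ σ := by
  rw [isPlanarRotation_iff] at h ⊢
  rw [numClasses_mul_comm, orbitSetoid, sup_comm]
  rw [orbitSetoid] at h
  omega

theorem IsPlanarRotation.inv (h : IsPlanarRotation σ τ) : IsPlanarRotation σ⁻¹ τ⁻¹ := by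
  rw [isPlanarRotation_iff] at h ⊢
  rw [orbitSetoid, cycleSetoid_inv, cycleSetoid_inv, ← mul_inv_rev, cycleSetoid_inv,
    numClasses_mul_comm]
  exact h

variable [Finite X]

theorem numClasses_le_card (r : Setoid X) : numClasses r ≤ Nat.card X :=
  Nat.card_le_card_of_surjective (Quotient.mk r) Quotient.mk_surjective

variable [DecidableEq X]

/-- The genus is nonnegative. -/
theorem numClasses_add_le (σ τ : Perm X) :
    numClasses (cycleSetoid σ) + numClasses (cycleSetoid τ) + numClasses (cycleSetoid (τ * σ))
      ≤ Nat.card X + 2 * numClasses (orbitSetoid σ τ) := by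
  induction hk : Nat.card X - numClasses (cycleSetoid τ) using Nat.strong_induction_on
    generalizing τ with
  | _ k ih =>
  by_cases h1 : τ = 1
  · subst h1
    have h2 : cycleSetoid (1 : Perm X) ≤ cycleSetoid σ := cycleSetoid_le fun x => Setoid.refl' _ _
    rw [one_mul, orbitSetoid, sup_eq_left.2 h2]
    have := numClasses_le_card (cycleSetoid (1 : Perm X))
    omega
  · obtain ⟨b, hb⟩ : ∃ b, τ b ≠ b := by
      by_contra! hc
      exact h1 (Equiv.ext hc)
    have hs : cycleSetoid τ (τ b) b := Setoid.symm' _ (cycleSetoid_apply b)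
    have e1 := numClasses_swap_mul hb hs
    have e2 := cycleSetoid_eq_of_split hs
    -- This makes `b` a fixed point of `τ'`, which has one cycle more than `τ`; the induction ends
    -- at the identity.
    set τ' := swap (τ b) b * τ with hτ'
    have hle := numClasses_le_card (cycleSetoid τ')
    have ih' := ih _ (by omega) τ' rfl
    have hO : orbitSetoid σ τ = mergeSetoid (orbitSetoid σ τ') (τ b) b := by
      rw [orbitSetoid, e2, sup_mergeSetoid]
    have hm : τ' * σ = swap (τ b) b * (τ * σ) := by rw [hτ', mul_assoc]
    rw [hm] at ih'
    -- Passing to `τ'` either cuts a face, and then the number of components grows by at most one,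
    -- or it joins two faces, and then the components do not change.
    by_cases hf : cycleSetoid (τ * σ) (τ b) b
    · have e3 := numClasses_swap_mul hb hf
      have := numClasses_mergeSetoid_le (r := orbitSetoid σ τ') (a := τ b) (b := b)
      rw [← hO] at this
      omega
    · have e3 := numClasses_swap_mul_of_not hf
      have e4 : orbitSetoid σ τ' (τ b) b := by
        have h5 : cycleSetoid (τ' * σ) (τ b) b := by
          rw [hm, cycleSetoid_swap_mul_of_not hf]
          exact mergeSetoid_self
        exact cycleSetoid_mul_le h5
      rw [mergeSetoid_eq_self e4] at hO
      rw [hO]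
      omega

/-- Splitting a vertex preserves planarity. -/
theorem IsPlanarRotation.split (h : IsPlanarRotation σ τ) (hab : cycleSetoid τ a b) :
    IsPlanarRotation σ (swap a b * τ) := by
  by_cases hne : a = b
  · subst hne
    simpa [swap_self, ← Perm.one_def] using h
  have hg := numClasses_add_le σ (swap a b * τ)
  rw [isPlanarRotation_iff] at h ⊢
  have e1 := numClasses_swap_mul hne hab
  have hO : orbitSetoid σ τ = mergeSetoid (orbitSetoid σ (swap a b * τ)) a b := by
    rw [orbitSetoid, cycleSetoid_eq_of_split hab, sup_mergeSetoid]
  have hO2 := numClasses_mergeSetoid_le (r := orbitSetoid σ (swap a b * τ)) (a := a) (b := b)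
  rw [← hO] at hO2
  rw [mul_assoc] at hg ⊢
  -- If a face is cut, vertices and faces together grow by two, and nonnegativity of the genus
  -- forces a new component. If two faces are joined, the vertex gained balances the face lost and
  -- the components stay the same.
  by_cases hf : cycleSetoid (τ * σ) a b
  · have e3 := numClasses_swap_mul hne hf
    omega
  · have e3 := numClasses_swap_mul_of_not hf
    have e4 : orbitSetoid σ (swap a b * τ) a b := by
      have h5 : cycleSetoid (swap a b * τ * σ) a b := by
        rw [mul_assoc, cycleSetoid_swap_mul_of_not hf]
        exact mergeSetoid_self
      exact cycleSetoid_mul_le h5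
    rw [mergeSetoid_eq_self e4] at hO
    rw [hO] at h
    omega

/-- Merging two vertices at a common face, or in different components, preserves planarity. -/
theorem IsPlanarRotation.merge (h : IsPlanarRotation σ τ) (hab : ¬ cycleSetoid τ a b)
    (hf : cycleSetoid (τ * σ) a b ∨ ¬ orbitSetoid σ τ a b) :
    IsPlanarRotation σ (swap a b * τ) := by
  have hne : a ≠ b := fun h => hab (h ▸ Setoid.refl' _ _)
  rw [isPlanarRotation_iff] at h ⊢
  have e1 := numClasses_swap_mul_of_not hab
  have hO : orbitSetoid σ (swap a b * τ) = mergeSetoid (orbitSetoid σ τ) a b := by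
    rw [orbitSetoid, cycleSetoid_swap_mul_of_not hab, sup_mergeSetoid]
  rw [mul_assoc, hO]
  by_cases hO' : orbitSetoid σ τ a b
  · rw [mergeSetoid_eq_self hO']
    have := numClasses_swap_mul hne (hf.resolve_right fun h => h hO')
    omega
  · have h3 : ¬ cycleSetoid (τ * σ) a b := fun h => hO' (cycleSetoid_mul_le h)
    have h4 := numClasses_mergeSetoid hO'
    have := numClasses_swap_mul_of_not h3
    omega

theorem IsPlanarRotation.split_left (h : IsPlanarRotation σ τ) (hab : cycleSetoid σ a b) :
    IsPlanarRotation (swap a b * σ) τ :=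
  (h.symm.split hab).symm

theorem IsPlanarRotation.merge_left_mul (h : IsPlanarRotation σ τ) (hab : ¬ cycleSetoid σ a b)
    (hf : cycleSetoid (τ * σ) a b ∨ ¬ orbitSetoid σ τ a b) :
    IsPlanarRotation (σ * swap a b) τ := by
  -- Inverting both rotations and exchanging the two parts turns right multiplication of `σ` into
  -- the left multiplication treated by `IsPlanarRotation.merge`.
  have h1 := h.inv.symm
  rw [← cycleSetoid_inv] at hab
  rw [← cycleSetoid_inv, mul_inv_rev, orbitSetoid, ← cycleSetoid_inv (π := σ),
    ← cycleSetoid_inv (π := τ), sup_comm] at hf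
  have h2 := (h1.merge hab hf).inv.symm
  simpa using h2

end Planar

end Gadget

namespace Gadget

open Equiv

/-! ### Planar partitions -/

/-- The partition `s` is the partition into the cycles of a rotation that is planar together
with `σ`. -/
def IsPlanarPartition {X : Type} (σ : Perm X) (s : Setoid X) : Prop :=
  ∃ τ : Perm X, cycleSetoid τ = s ∧ IsPlanarRotation σ τ

/-- The disjoint union of two equivalence relations. -/
def sumSetoid {X Y : Type} (r : Setoid X) (s : Setoid Y) : Setoid (X ⊕ Y) where
  r := Sum.LiftRel r s
  iseqv := by
    refine ⟨?_, ?_, ?_⟩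
    · rintro (x | y)
      · exact Sum.LiftRel.inl (r.refl' x)
      · exact Sum.LiftRel.inr (s.refl' y)
    · rintro _ _ (h | h)
      · exact Sum.LiftRel.inl (r.symm' h)
      · exact Sum.LiftRel.inr (s.symm' h)
    · rintro _ _ _ (h | h) (k | k)
      · exact Sum.LiftRel.inl (r.trans' h k)
      · exact Sum.LiftRel.inr (s.trans' h k)

section

variable {X Y : Type}

@[simp] theorem sumSetoid_inl {r : Setoid X} {s : Setoid Y} {x x' : X} :
    sumSetoid r s (Sum.inl x) (Sum.inl x') ↔ r x x' := Sum.liftRel_inl_inl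

@[simp] theorem sumSetoid_inr {r : Setoid X} {s : Setoid Y} {y y' : Y} :
    sumSetoid r s (Sum.inr y) (Sum.inr y') ↔ s y y' := Sum.liftRel_inr_inr

@[simp] theorem not_sumSetoid_inl_inr {r : Setoid X} {s : Setoid Y} {x : X} {y : Y} :
    ¬ sumSetoid r s (Sum.inl x) (Sum.inr y) := Sum.not_liftRel_inl_inr

@[simp] theorem not_sumSetoid_inr_inl {r : Setoid X} {s : Setoid Y} {x : X} {y : Y} :
    ¬ sumSetoid r s (Sum.inr y) (Sum.inl x) := Sum.not_liftRel_inr_inl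

theorem sumSetoid_mono {r r' : Setoid X} {s s' : Setoid Y} (hr : r ≤ r') (hs : s ≤ s') :
    sumSetoid r s ≤ sumSetoid r' s' := by
  rintro _ _ (h | h)
  · exact Sum.LiftRel.inl (hr h)
  · exact Sum.LiftRel.inr (hs h)

theorem sumSetoid_sup (r r' : Setoid X) (s s' : Setoid Y) :
    sumSetoid r s ⊔ sumSetoid r' s' = sumSetoid (r ⊔ r') (s ⊔ s') := by
  apply le_antisymm
  · exact sup_le (sumSetoid_mono le_sup_left le_sup_left)
      (sumSetoid_mono le_sup_right le_sup_right)
  · have h1 : r ⊔ r' ≤ Setoid.comap Sum.inl (sumSetoid r s ⊔ sumSetoid r' s') :=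
      sup_le (fun _ _ h => (le_sup_left : sumSetoid r s ≤ _) (Sum.LiftRel.inl h))
        (fun _ _ h => (le_sup_right : sumSetoid r' s' ≤ _) (Sum.LiftRel.inl h))
    have h2 : s ⊔ s' ≤ Setoid.comap Sum.inr (sumSetoid r s ⊔ sumSetoid r' s') :=
      sup_le (fun _ _ h => (le_sup_left : sumSetoid r s ≤ _) (Sum.LiftRel.inr h))
        (fun _ _ h => (le_sup_right : sumSetoid r' s' ≤ _) (Sum.LiftRel.inr h))
    rintro _ _ (h | h)
    · exact h1 h
    · exact h2 h

theorem numClasses_sumSetoid [Finite X] [Finite Y] (r : Setoid X) (s : Setoid Y) :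
    numClasses (sumSetoid r s) = numClasses r + numClasses s := by
  rw [numClasses_of_ker (Sum.map (Quotient.mk r) (Quotient.mk s))
    (Sum.map_surjective.2 ⟨Quotient.mk_surjective, Quotient.mk_surjective⟩), Nat.card_sum]
  · rfl
  · rintro (x | x) (y | y)
    · simpa using (Quotient.eq (r := r)).symm
    · simp
    · simp
    · simpa using (Quotient.eq (r := s)).symm

theorem cycleSetoid_sumCongr (σ : Perm X) (τ : Perm Y) :
    cycleSetoid (Perm.sumCongr σ τ) = sumSetoid (cycleSetoid σ) (cycleSetoid τ) := by
  apply le_antisymm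
  · refine cycleSetoid_le ?_
    rintro (x | y)
    · exact Sum.LiftRel.inl (cycleSetoid_apply x)
    · exact Sum.LiftRel.inr (cycleSetoid_apply y)
  · have h1 : cycleSetoid σ ≤ Setoid.comap Sum.inl (cycleSetoid (Perm.sumCongr σ τ)) :=
      cycleSetoid_le fun x => cycleSetoid_apply (π := Perm.sumCongr σ τ) (Sum.inl x)
    have h2 : cycleSetoid τ ≤ Setoid.comap Sum.inr (cycleSetoid (Perm.sumCongr σ τ)) :=
      cycleSetoid_le fun x => cycleSetoid_apply (π := Perm.sumCongr σ τ) (Sum.inr x)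
    rintro _ _ (h | h)
    · exact h1 h
    · exact h2 h

theorem orbitSetoid_sumCongr (σ τ : Perm X) (σ' τ' : Perm Y) :
    orbitSetoid (Perm.sumCongr σ σ') (Perm.sumCongr τ τ')
      = sumSetoid (orbitSetoid σ τ) (orbitSetoid σ' τ') := by
  rw [orbitSetoid, cycleSetoid_sumCongr, cycleSetoid_sumCongr, sumSetoid_sup]

theorem numClasses_comap (e : X ≃ Y) (r : Setoid Y) :
    numClasses (Setoid.comap e r) = numClasses r :=
  Nat.card_congr (Quotient.congr e fun _ _ => Iff.rfl)

theorem cycleSetoid_of_semiconj {e : X ≃ Y} {σ : Perm X} {σ' : Perm Y}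
    (h : ∀ x, e (σ x) = σ' (e x)) : cycleSetoid σ = Setoid.comap e (cycleSetoid σ') := by
  apply le_antisymm
  · refine cycleSetoid_le fun x => ?_
    rw [Setoid.comap_rel, h]
    exact cycleSetoid_apply _
  · have h1 : cycleSetoid σ' ≤ Setoid.comap e.symm (cycleSetoid σ) := by
      refine cycleSetoid_le fun y => ?_
      obtain ⟨x, rfl⟩ := e.surjective y
      rw [← h, Setoid.comap_rel, e.symm_apply_apply, e.symm_apply_apply]
      exact cycleSetoid_apply _
    intro x y hxy
    have := h1 hxy
    simpa [Setoid.comap_rel] using this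

theorem comap_sup (e : X ≃ Y) (r s : Setoid Y) :
    Setoid.comap e (r ⊔ s) = Setoid.comap e r ⊔ Setoid.comap e s := by
  apply le_antisymm
  · have h1 : r ⊔ s ≤ Setoid.comap e.symm (Setoid.comap e r ⊔ Setoid.comap e s) := by
      refine sup_le ?_ ?_
      · intro x y h
        refine (le_sup_left : Setoid.comap e r ≤ _) ?_
        simpa [Setoid.comap_rel] using h
      · intro x y h
        refine (le_sup_right : Setoid.comap e s ≤ _) ?_
        simpa [Setoid.comap_rel] using h
    intro x y hxy
    have := h1 hxy
    simpa [Setoid.comap_rel] using this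
  · exact sup_le (fun _ _ h => (le_sup_left : r ≤ r ⊔ s) h)
      (fun _ _ h => (le_sup_right : s ≤ r ⊔ s) h)

theorem isPlanarRotation_of_semiconj {e : X ≃ Y} {σ τ : Perm X} {σ' τ' : Perm Y}
    (hσ : ∀ x, e (σ x) = σ' (e x)) (hτ : ∀ x, e (τ x) = τ' (e x)) :
    IsPlanarRotation σ τ ↔ IsPlanarRotation σ' τ' := by
  have hm : ∀ x, e ((τ * σ) x) = (τ' * σ') (e x) := fun x => by simp [hτ, hσ]
  rw [isPlanarRotation_iff, isPlanarRotation_iff, orbitSetoid, cycleSetoid_of_semiconj hσ,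
    cycleSetoid_of_semiconj hτ, cycleSetoid_of_semiconj hm, ← comap_sup, numClasses_comap,
    numClasses_comap, numClasses_comap, numClasses_comap, Nat.card_congr e]

theorem IsPlanarPartition.transport {σ : Perm X} {s : Setoid X} (h : IsPlanarPartition σ s)
    (e : X ≃ Y) {σ' : Perm Y} {s' : Setoid Y} (hσ : ∀ x, e (σ x) = σ' (e x))
    (hs : ∀ x y, s x y ↔ s' (e x) (e y)) : IsPlanarPartition σ' s' := by
  obtain ⟨τ, rfl, hp⟩ := h
  have hτ : ∀ x, e (τ x) = e.permCongr τ (e x) := fun x => by simp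
  refine ⟨e.permCongr τ, ?_, (isPlanarRotation_of_semiconj hσ hτ).1 hp⟩
  have h1 := cycleSetoid_of_semiconj hτ
  ext x y
  obtain ⟨x, rfl⟩ := e.surjective x
  obtain ⟨y, rfl⟩ := e.surjective y
  rw [← hs, h1]
  rfl

theorem IsPlanarPartition.inv {σ : Perm X} {s : Setoid X} (h : IsPlanarPartition σ s) :
    IsPlanarPartition σ⁻¹ s := by
  obtain ⟨τ, rfl, hp⟩ := h
  exact ⟨τ⁻¹, cycleSetoid_inv, hp.inv⟩

variable [Finite X] [Finite Y]

theorem IsPlanarPartition.sum {σ : Perm X} {s : Setoid X} {σ' : Perm Y} {s' : Setoid Y}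
    (h : IsPlanarPartition σ s) (h' : IsPlanarPartition σ' s') :
    IsPlanarPartition (Perm.sumCongr σ σ') (sumSetoid s s') := by
  obtain ⟨τ, rfl, hp⟩ := h
  obtain ⟨τ', rfl, hp'⟩ := h'
  refine ⟨Perm.sumCongr τ τ', cycleSetoid_sumCongr _ _, ?_⟩
  rw [isPlanarRotation_iff] at hp hp' ⊢
  rw [orbitSetoid_sumCongr, Perm.sumCongr_mul, cycleSetoid_sumCongr, cycleSetoid_sumCongr,
    cycleSetoid_sumCongr, numClasses_sumSetoid, numClasses_sumSetoid, numClasses_sumSetoid,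
    numClasses_sumSetoid, Nat.card_sum]
  omega

/-- Joining two components at a vertex of the first part. -/
theorem IsPlanarPartition.sum_join [DecidableEq X] [DecidableEq Y] {σ : Perm X} {s : Setoid X}
    {σ' : Perm Y} {s' : Setoid Y} (h : IsPlanarPartition σ s) (h' : IsPlanarPartition σ' s')
    (x : X) (y : Y) :
    IsPlanarPartition (Perm.sumCongr σ σ' * swap (Sum.inl x) (Sum.inr y)) (sumSetoid s s') := by
  obtain ⟨τ, hτ, hp⟩ := h.sum h'
  refine ⟨τ, hτ, hp.merge_left_mul ?_ (Or.inr ?_)⟩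
  · rw [cycleSetoid_sumCongr]
    exact not_sumSetoid_inl_inr
  · have : orbitSetoid (Perm.sumCongr σ σ') τ
        ≤ sumSetoid (orbitSetoid σ 1 ⊔ s) (orbitSetoid σ' 1 ⊔ s') := by
      rw [orbitSetoid, hτ, cycleSetoid_sumCongr, sumSetoid_sup]
      exact sumSetoid_mono (sup_le_sup le_sup_left le_rfl) (sup_le_sup le_sup_left le_rfl)
    exact fun hxy => not_sumSetoid_inl_inr (this hxy)

omit [Finite X] in
theorem numClasses_eq_one [Subsingleton X] [Nonempty X] (r : Setoid X) : numClasses r = 1 := by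
  rw [numClasses_of_ker (fun _ => ()) (fun _ => ⟨Classical.arbitrary X, rfl⟩), Nat.card_unique]
  intro x y
  rw [Subsingleton.elim x y]
  exact ⟨fun _ => rfl, fun _ => r.refl' _⟩

theorem isPlanarRotation_of_sumCongr_unit {σ τ : Perm X} {α β : Perm Unit}
    (h : IsPlanarRotation (Perm.sumCongr σ α) (Perm.sumCongr τ β)) : IsPlanarRotation σ τ := by
  rw [isPlanarRotation_iff] at h ⊢
  rw [orbitSetoid_sumCongr, Perm.sumCongr_mul, cycleSetoid_sumCongr, cycleSetoid_sumCongr,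
    cycleSetoid_sumCongr, numClasses_sumSetoid, numClasses_sumSetoid, numClasses_sumSetoid,
    numClasses_sumSetoid, Nat.card_sum] at h
  simp only [numClasses_eq_one (X := Unit), Nat.card_unique] at h
  omega

/-- Deleting the edge `e (Sum.inr ())` preserves planarity. -/
theorem IsPlanarPartition.delete [DecidableEq X] {σ : Perm X} {s : Setoid X}
    (h : IsPlanarPartition σ s) (e : Y ⊕ Unit ≃ X) {σ' : Perm Y}
    (hσ : ∀ y, e (Sum.inl (σ' y)) = if σ (e (Sum.inl y)) = e (Sum.inr ()) then
      σ (e (Sum.inr ())) else σ (e (Sum.inl y))) :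
    IsPlanarPartition σ' (Setoid.comap (fun y => e (Sum.inl y)) s) := by
  obtain ⟨τ, rfl, hp⟩ := h
  set a := e (Sum.inr ()) with ha
  have hne : ∀ y, e (Sum.inl y) ≠ a := fun y hy => by simpa using e.injective hy
  -- Splitting `a` off at both of its ends makes it a fixed point of both rotations, hence a
  -- component of its own that can be discarded.
  have hp1 := (hp.split (cycleSetoid_apply a)).split_left (cycleSetoid_apply a)
  set τ₁ := swap a (τ a) * τ with hτ₁
  have hfix : τ₁ a = a := by simp [hτ₁]
  have hmem : e.symm.permCongr τ₁ ∈ (Perm.sumCongrHom Y Unit).range := by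
    refine Perm.mem_sumCongrHom_range_of_perm_mapsTo_inl ?_
    rw [Perm.perm_mapsTo_inl_iff_mapsTo_inr]
    rintro _ ⟨u, rfl⟩
    exact ⟨(), by simp [← ha, hfix, Equiv.eq_symm_apply]⟩
  obtain ⟨⟨τ', β⟩, hτ'⟩ := hmem
  have hτe : ∀ z, e (Perm.sumCongr τ' β z) = τ₁ (e z) := by
    intro z
    have := congrArg (fun p : Perm (Y ⊕ Unit) => e (p z)) hτ'
    simpa using this
  have hσe : ∀ z, e (Perm.sumCongr σ' 1 z) = (swap a (σ a) * σ) (e z) := by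
    rintro (y | u)
    · simp only [Perm.sumCongr_apply, Sum.map_inl, hσ, Perm.mul_apply]
      split_ifs with hy
      · rw [hy, swap_apply_left]
      · rw [swap_apply_of_ne_of_ne hy]
        exact fun h => hne y (σ.injective h)
    · simp [← ha]
  refine ⟨τ', ?_, isPlanarRotation_of_sumCongr_unit
    ((isPlanarRotation_of_semiconj hσe hτe).2 hp1)⟩
  have h1 : cycleSetoid τ = mergeSetoid (cycleSetoid τ₁) a (τ a) :=
    cycleSetoid_eq_of_split (cycleSetoid_apply a)
  have h2 := cycleSetoid_of_semiconj hτe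
  ext x y
  have h3 : cycleSetoid τ' x y ↔ cycleSetoid τ₁ (e (Sum.inl x)) (e (Sum.inl y)) := by
    rw [← Setoid.comap_rel, ← h2, cycleSetoid_sumCongr, sumSetoid_inl]
  have h4 : ∀ z, ¬ cycleSetoid τ₁ a (e (Sum.inl z)) := fun z hz =>
    hne z (Perm.SameCycle.eq_of_left hz hfix).symm
  rw [h3, Setoid.comap_rel, h1, mergeSetoid_rel]
  constructor
  · exact Or.inl
  · rintro (h | ⟨h, -⟩ | ⟨-, h⟩)
    · exact h
    · exact absurd (Setoid.symm' _ h) (h4 x)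
    · exact absurd h (h4 y)

omit [Finite Y] in
/-- Merging the ends of two consecutive edges preserves planarity. -/
theorem IsPlanarPartition.merge [DecidableEq X] {σ : Perm X} {s : Setoid X}
    (h : IsPlanarPartition σ s) (a : X) : IsPlanarPartition σ (mergeSetoid s a (σ a)) := by
  by_cases hs : s a (σ a)
  · rwa [mergeSetoid_eq_self hs]
  · obtain ⟨τ, rfl, hp⟩ := h
    have h1 : ¬ cycleSetoid τ a (τ (σ a)) := fun h =>
      hs (Setoid.trans' _ h (Setoid.symm' _ (cycleSetoid_apply _)))
    -- The edge after `a` on its face is `τ (σ a)`, which ends at the same vertex as `σ a`; so the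
    -- two vertices meet at a common face.
    refine ⟨swap a (τ (σ a)) * τ, ?_, hp.merge h1 (Or.inl (cycleSetoid_apply (π := τ * σ) a))⟩
    rw [cycleSetoid_swap_mul_of_not h1]
    exact mergeSetoid_congr (Setoid.refl' _ _) (Setoid.symm' _ (cycleSetoid_apply _))

end

end Gadget

namespace Gadget

open Equiv

/-! ### Planarity with a cyclic list of dangling edges -/

theorem val_finRotate {n : ℕ} (i : Fin n) :
    (finRotate n i : ℕ) = if (i : ℕ) + 1 = n then 0 else (i : ℕ) + 1 := by
  obtain ⟨k, hk⟩ := i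
  cases n with
  | zero => omega
  | succ n =>
    split_ifs with h
    · simp only [Nat.add_right_cancel_iff] at h
      subst h
      rw [finRotate_last']
    · rw [finRotate_of_lt (by simp at h; omega)]

theorem reverse_ofFn {α : Type} {n : ℕ} (v : Fin n → α) :
    (List.ofFn v).reverse = List.ofFn (v ∘ Fin.rev) := by
  refine List.ext_getElem (by simp) fun i h₁ h₂ => ?_
  simp only [List.getElem_reverse, List.getElem_ofFn, List.length_ofFn, Function.comp_apply]
  congr 1
  ext
  simp [Fin.val_rev]
  omega

/-- Internal edges `S` with vertex rotation `ρ` and cyclically ordered dangling edges, attached to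
vertices in `E` by `u` and `ℓ`, form a planar rotation system after identifying vertices
along `r`. -/
def CyclicallyPlanar {S E : Type} (r : Setoid E) (ρ : Perm S) (u : S → E) (ℓ : List E) : Prop :=
  IsPlanarPartition (Perm.sumCongr ρ (finRotate ℓ.length)) (Setoid.comap (Sum.elim u ℓ.get) r)

section

variable {S E : Type} {r : Setoid E} {ρ : Perm S} {u : S → E}

theorem cyclicallyPlanar_iff {n : ℕ} {ℓ : List E} (v : Fin n → E) (h : ℓ = List.ofFn v) :
    CyclicallyPlanar r ρ u ℓ ↔
      IsPlanarPartition (Perm.sumCongr ρ (finRotate n)) (Setoid.comap (Sum.elim u v) r) := by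
  have hn : ℓ.length = n := by simp [h]
  subst hn
  have : v = ℓ.get := List.ofFn_injective (by rw [← h, List.ofFn_get])
  subst this
  rfl

theorem CyclicallyPlanar.rotate_cons {a : E} {ℓ : List E}
    (h : CyclicallyPlanar r ρ u (a :: ℓ)) : CyclicallyPlanar r ρ u (ℓ ++ [a]) := by
  rw [cyclicallyPlanar_iff ((a :: ℓ).get ∘ finRotate (a :: ℓ).length)]
  · refine IsPlanarPartition.transport h
      ((Equiv.refl S).sumCongr (finRotate (a :: ℓ).length).symm) ?_ ?_
    · rintro (x | i) <;> simp
    · rintro (x | i) (y | j) <;> simp [Setoid.comap_rel]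
  · refine List.ext_getElem (by simp) fun i h₁ h₂ => ?_
    simp only [List.getElem_ofFn, Function.comp_apply, List.get_eq_getElem, val_finRotate]
    by_cases hi : i = ℓ.length
    · simp [hi]
    · have : i < ℓ.length := by simp at h₁; omega
      simp [hi, this]

theorem CyclicallyPlanar.of_isRotated {ℓ ℓ' : List E} (h : CyclicallyPlanar r ρ u ℓ)
    (hr : ℓ ~r ℓ') : CyclicallyPlanar r ρ u ℓ' := by
  obtain ⟨n, rfl⟩ := hr
  induction n generalizing ℓ with
  | zero => simpa using h
  | succ n ih =>
    cases ℓ with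
    | nil => simpa using h
    | cons a ℓ =>
      rw [List.rotate_cons_succ]
      exact ih h.rotate_cons

theorem CyclicallyPlanar.append_comm {ℓ ℓ' : List E} (h : CyclicallyPlanar r ρ u (ℓ ++ ℓ')) :
    CyclicallyPlanar r ρ u (ℓ' ++ ℓ) :=
  h.of_isRotated List.isRotated_append

/-- The mirror image inverts every rotation, and `Fin.rev` conjugates the inverse of `finRotate`
back into `finRotate`. -/
theorem CyclicallyPlanar.reverse {ℓ : List E} (h : CyclicallyPlanar r ρ u ℓ) :
    CyclicallyPlanar r ρ⁻¹ u ℓ.reverse := by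
  rw [cyclicallyPlanar_iff (ℓ.get ∘ Fin.rev) (by rw [← reverse_ofFn, List.ofFn_get])]
  refine (IsPlanarPartition.inv h).transport ((Equiv.refl S).sumCongr Fin.revPerm) ?_ ?_
  · rintro (x | i)
    · rfl
    · obtain ⟨j, rfl⟩ := (finRotate ℓ.length).surjective i
      have h1 : (Perm.sumCongr ρ (finRotate ℓ.length))⁻¹ (Sum.inr (finRotate ℓ.length j))
          = Sum.inr j := by
        rw [Perm.inv_eq_iff_eq]; rfl
      rw [h1]
      simp only [Equiv.sumCongr_apply, Sum.map_inr, Fin.revPerm_apply, Sum.inr.injEq]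
      ext
      have := j.isLt
      simp only [val_finRotate, Fin.val_rev]
      split_ifs <;> omega
  · rintro (x | i) (y | j) <;> simp [Setoid.comap_rel]

/-- Identifications recorded by `r` are carried out by a map `f` with kernel `r`, which is how the
result of surgery becomes an actual gadget. -/
theorem CyclicallyPlanar.map_bot {S' E' : Type} {ρ' : Perm S'} {u' : S' → E'} {ℓ : List E}
    (h : CyclicallyPlanar r ρ u ℓ) (e : S ≃ S') (hρ : ∀ x, e (ρ x) = ρ' (e x)) (f : E → E')
    (hf : ∀ x y, r x y ↔ f x = f y) (hu : ∀ x, u' (e x) = f (u x)) :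
    CyclicallyPlanar ⊥ ρ' u' (ℓ.map f) := by
  rw [cyclicallyPlanar_iff (f ∘ ℓ.get) (by simp [← List.map_ofFn])]
  refine IsPlanarPartition.transport h (e.sumCongr (Equiv.refl _)) ?_ ?_
  · rintro (x | i) <;> simp [hρ]
  · rintro (x | i) (y | j) <;> simp [Setoid.comap_rel, hf, hu]

/-- Exchanging the successors of the two last elements makes each cycle continue into the start of
the other, which is the rotation of the concatenation. -/
theorem finSumFinEquiv_swap {m n : ℕ} (z : Fin (m + 1) ⊕ Fin (n + 1)) :
    finSumFinEquiv ((Perm.sumCongr (finRotate (m + 1)) (finRotate (n + 1)) *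
        swap (Sum.inl (Fin.last m)) (Sum.inr (Fin.last n))) z)
      = finRotate (m + 1 + (n + 1)) (finSumFinEquiv z) := by
  ext
  rcases z with i | j
  · have := i.isLt
    by_cases hi : i = Fin.last m
    · subst hi
      simp only [Perm.mul_apply, swap_apply_left, Perm.sumCongr_apply,
        Sum.map_inr, finSumFinEquiv_apply_left, finSumFinEquiv_apply_right,
        Fin.val_castAdd, Fin.val_natAdd, val_finRotate, Fin.val_last]
      split_ifs <;> omega
    · have h1 : (i : ℕ) ≠ m := fun h => hi (Fin.ext h)
      rw [Perm.mul_apply, swap_apply_of_ne_of_ne (by simpa using hi) (by simp)]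
      simp only [Perm.sumCongr_apply, Sum.map_inl, finSumFinEquiv_apply_left, Fin.val_castAdd,
        val_finRotate]
      split_ifs <;> omega
  · have := j.isLt
    by_cases hj : j = Fin.last n
    · subst hj
      simp only [Perm.mul_apply, swap_apply_right, Perm.sumCongr_apply,
        Sum.map_inl, finSumFinEquiv_apply_left, finSumFinEquiv_apply_right,
        Fin.val_castAdd, Fin.val_natAdd, val_finRotate, Fin.val_last]
      split_ifs <;> omega
    · have h1 : (j : ℕ) ≠ n := fun h => hj (Fin.ext h)
      rw [Perm.mul_apply, swap_apply_of_ne_of_ne (by simp) (by simpa using hj)]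
      simp only [Perm.sumCongr_apply, Sum.map_inr, finSumFinEquiv_apply_right, Fin.val_natAdd,
        val_finRotate]
      split_ifs <;> omega

theorem finSumFinEquiv_sumCongr {m n : ℕ} (h : m = 0 ∨ n = 0) (z : Fin m ⊕ Fin n) :
    finSumFinEquiv (Perm.sumCongr (finRotate m) (finRotate n) z)
      = finRotate (m + n) (finSumFinEquiv z) := by
  ext
  rcases z with i | j
  · have := i.isLt
    simp only [Perm.sumCongr_apply, Sum.map_inl, finSumFinEquiv_apply_left, Fin.val_castAdd,
      val_finRotate]
    split_ifs <;> omega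
  · have := j.isLt
    simp only [Perm.sumCongr_apply, Sum.map_inr, finSumFinEquiv_apply_right, Fin.val_natAdd,
      val_finRotate]
    split_ifs <;> omega

variable [Finite S]

/-- The two copies of infinity lie in different components and are merged at their last dangling
edges. If one side has no dangling edge, its infinity is absent from the rotation system and nothing
has to be merged. -/
theorem CyclicallyPlanar.union {S' E' : Type} [Finite S'] {r' : Setoid E'} {ρ' : Perm S'}
    {u' : S' → E'} {ℓ : List E} {ℓ' : List E'} (h : CyclicallyPlanar r ρ u ℓ)
    (h' : CyclicallyPlanar r' ρ' u' ℓ') :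
    CyclicallyPlanar (sumSetoid r r') (Perm.sumCongr ρ ρ') (Sum.map u u')
      (ℓ.map Sum.inl ++ ℓ'.map Sum.inr) := by
  classical
  obtain ⟨m, v, rfl⟩ : ∃ (m : ℕ) (v : Fin m → E), ℓ = List.ofFn v := ⟨_, _, (List.ofFn_get ℓ).symm⟩
  obtain ⟨n, v', rfl⟩ : ∃ (n : ℕ) (v' : Fin n → E'), ℓ' = List.ofFn v' :=
    ⟨_, _, (List.ofFn_get ℓ').symm⟩
  rw [cyclicallyPlanar_iff _ rfl] at h h'
  rw [cyclicallyPlanar_iff (Fin.append (Sum.inl ∘ v) (Sum.inr ∘ v'))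
    (by rw [List.ofFn_fin_append, List.map_ofFn, List.map_ofFn])]
  have hlab : ∀ x y, sumSetoid (Setoid.comap (Sum.elim u v) r) (Setoid.comap (Sum.elim u' v') r') x y
      ↔ Setoid.comap (Sum.elim (Sum.map u u') (Fin.append (Sum.inl ∘ v) (Sum.inr ∘ v')))
        (sumSetoid r r')
        (((Equiv.sumSumSumComm S (Fin m) S' (Fin n)).trans
          ((Equiv.refl _).sumCongr finSumFinEquiv)) x)
        (((Equiv.sumSumSumComm S (Fin m) S' (Fin n)).trans
          ((Equiv.refl _).sumCongr finSumFinEquiv)) y) := by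
    rintro ((x | x) | (x | x)) ((y | y) | (y | y)) <;> simp [Setoid.comap_rel]
  by_cases h0 : m = 0 ∨ n = 0
  · refine (h.sum h').transport ((Equiv.sumSumSumComm S (Fin m) S' (Fin n)).trans
      ((Equiv.refl _).sumCongr finSumFinEquiv)) ?_ hlab
    have := finSumFinEquiv_sumCongr h0
    rintro ((x | x) | (x | x))
    · rfl
    · simpa using this (Sum.inl x)
    · rfl
    · simpa using this (Sum.inr x)
  · push Not at h0
    obtain ⟨m, rfl⟩ := Nat.exists_eq_succ_of_ne_zero h0.1
    obtain ⟨n, rfl⟩ := Nat.exists_eq_succ_of_ne_zero h0.2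
    refine (h.sum_join h' (Sum.inr (Fin.last m)) (Sum.inr (Fin.last n))).transport
      ((Equiv.sumSumSumComm S (Fin (m + 1)) S' (Fin (n + 1))).trans
      ((Equiv.refl _).sumCongr finSumFinEquiv)) ?_ hlab
    have := @finSumFinEquiv_swap m n
    rintro ((x | x) | (x | x))
    · rw [Perm.mul_apply, swap_apply_of_ne_of_ne (by simp) (by simp)]
      rfl
    · have h1 := this (Sum.inl x)
      by_cases hx : x = Fin.last m
      · subst hx
        simpa using h1
      · rw [Perm.mul_apply, swap_apply_of_ne_of_ne (by simpa using hx) (by simp)] at h1 ⊢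
        simpa using h1
    · rw [Perm.mul_apply, swap_apply_of_ne_of_ne (by simp) (by simp)]
      rfl
    · have h1 := this (Sum.inr x)
      by_cases hx : x = Fin.last n
      · subst hx
        simpa using h1
      · rw [Perm.mul_apply, swap_apply_of_ne_of_ne (by simp) (by simpa using hx)] at h1 ⊢
        simpa using h1

theorem CyclicallyPlanar.tail {a : E} {ℓ : List E} (h : CyclicallyPlanar r ρ u (a :: ℓ)) :
    CyclicallyPlanar r ρ u ℓ := by
  classical
  obtain ⟨e, he₁, he₂, he₃⟩ : ∃ e : (S ⊕ Fin ℓ.length) ⊕ Unit ≃ S ⊕ Fin (a :: ℓ).length,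
      (∀ x, e (Sum.inl (Sum.inl x)) = Sum.inl x) ∧
      (∀ i : Fin ℓ.length, e (Sum.inl (Sum.inr i)) = Sum.inr i.succ) ∧
      e (Sum.inr ()) = Sum.inr ⟨0, by simp⟩ := by
    refine ⟨Equiv.ofBijective (Sum.elim (Sum.map id Fin.succ) fun _ => Sum.inr ⟨0, by simp⟩)
      ⟨?_, ?_⟩, fun _ => rfl, fun _ => rfl, rfl⟩
    · rintro ((x | i) | x) ((y | j) | y) hxy <;> simp [Fin.ext_iff] at hxy ⊢
      · exact hxy
      · exact hxy
    · rintro (x | i)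
      · exact ⟨Sum.inl (Sum.inl x), rfl⟩
      · cases i using Fin.cases with
        | zero => exact ⟨Sum.inr (), rfl⟩
        | succ i => exact ⟨Sum.inl (Sum.inr i), rfl⟩
  have hd := IsPlanarPartition.delete h e (σ' := Perm.sumCongr ρ (finRotate ℓ.length)) (by
    rintro (x | i)
    · simp [he₁, he₃]
    · simp only [Perm.sumCongr_apply, Sum.map_inr, he₂, he₃, Sum.inr.injEq]
      have hi := i.isLt
      by_cases h1 : (i : ℕ) + 1 = ℓ.length
      · rw [if_pos (Fin.ext (by rw [val_finRotate]; simp [h1]))]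
        refine congrArg _ (Fin.ext ?_)
        rw [val_finRotate, Fin.val_succ, val_finRotate, if_pos h1]
        simp only [List.length_cons]
        split_ifs <;> omega
      · rw [if_neg (by simp only [Fin.ext_iff, val_finRotate]; simp [h1])]
        refine congrArg _ (Fin.ext ?_)
        rw [val_finRotate, Fin.val_succ, val_finRotate, if_neg h1]
        simp [h1])
  unfold CyclicallyPlanar
  convert hd using 1
  ext x y
  rcases x with x | i <;> rcases y with y | j <;> simp [Setoid.comap_rel, he₁, he₂]

/-- Two neighbouring dangling edges bound a common face, so their ends can be merged; afterwards
both edges are deleted. -/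
theorem CyclicallyPlanar.contract {a b : E} {ℓ : List E}
    (h : CyclicallyPlanar r ρ u (a :: b :: ℓ)) : CyclicallyPlanar (mergeSetoid r a b) ρ u ℓ := by
  classical
  have h1 : CyclicallyPlanar (mergeSetoid r a b) ρ u (a :: b :: ℓ) := by
    have h2 := IsPlanarPartition.merge h (Sum.inr ⟨0, by simp⟩)
    have h3 : (Perm.sumCongr ρ (finRotate (a :: b :: ℓ).length)) (Sum.inr ⟨0, by simp⟩)
        = Sum.inr ⟨1, by simp⟩ :=
      congrArg Sum.inr (Fin.ext (by rw [val_finRotate]; simp))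
    rw [h3] at h2
    exact h2
  exact h1.tail.tail

/-- Merging the classes of all pairs in a list. -/
def mergeList (r : Setoid E) (P : List (E × E)) : Setoid E :=
  P.foldl (fun r p => mergeSetoid r p.1 p.2) r

omit [Finite S] in
theorem mergeList_le_iff {s : Setoid E} {P : List (E × E)} :
    mergeList r P ≤ s ↔ r ≤ s ∧ ∀ p ∈ P, s p.1 p.2 := by
  induction P generalizing r with
  | nil => simp [mergeList]
  | cons p P ih =>
    have : mergeList r (p :: P) = mergeList (mergeSetoid r p.1 p.2) P := rfl
    rw [this, ih]
    simp only [List.mem_cons, forall_eq_or_imp, ← and_assoc, and_congr_left_iff]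
    intro _
    exact ⟨fun h => ⟨le_mergeSetoid.trans h, h mergeSetoid_self⟩, fun h => mergeSetoid_le h.1 h.2⟩

/-- The first components are reversed, so the pairs are nested: the head of `P` is the innermost
pair and its members are neighbours. Contracting it makes the next pair neighbours. -/
theorem CyclicallyPlanar.contract_list {P : List (E × E)} {ℓ : List E}
    (h : CyclicallyPlanar r ρ u ((P.map Prod.fst).reverse ++ (P.map Prod.snd ++ ℓ))) :
    CyclicallyPlanar (mergeList r P) ρ u ℓ := by
  induction P generalizing r with
  | nil => exact h
  | cons p P ih =>
    refine ih (r := mergeSetoid r p.1 p.2) ?_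
    refine CyclicallyPlanar.append_comm (CyclicallyPlanar.contract ?_)
    have := CyclicallyPlanar.append_comm (ℓ := (P.map Prod.fst).reverse)
      (ℓ' := p.1 :: p.2 :: (P.map Prod.snd ++ ℓ)) (by simpa using h)
    simpa using this

end

end Gadget

namespace Gadget

open Equiv

/-! ### Planarity of gadgets -/

/-- The rotation of the inputs of a signature, clockwise or counterclockwise. -/
def orientedRotation (b : Bool) (n : ℕ) : Perm (Fin n) :=
  if b then finRotate n else (finRotate n)⁻¹

theorem orientedRotation_not (b : Bool) (n : ℕ) :
    orientedRotation (!b) n = (orientedRotation b n)⁻¹ := by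
  cases b <;> simp [orientedRotation]

theorem cast_orientedRotation (b : Bool) {m n : ℕ} (h : m = n) (i : Fin m) :
    Fin.cast h (orientedRotation b m i) = orientedRotation b n (Fin.cast h i) := by
  subst h
  rfl

/-- The rotations around all constraint vertices. -/
def vertexRotation {q : ℕ} {C : Type} (sig : C → ConstraintFunction q) (o : C → Bool) :
    Perm (Σ c, Fin (sig c).arity) :=
  Perm.sigmaCongrRight fun c => orientedRotation (o c) (sig c).arity

section

variable {q m d : ℕ}

theorem vertexRotation_apply {C : Type} {sig : C → ConstraintFunction q} {o : C → Bool} (c : C)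
    (i : Fin (sig c).arity) :
    vertexRotation sig o ⟨c, i⟩ = ⟨c, orientedRotation (o c) _ i⟩ := rfl

/-- The dangling edges of a gadget in cyclic order. -/
def boundary (K : Gadget q m d) : List K.E := List.ofFn K.out ++ (List.ofFn K.inp).reverse

theorem isPlanar_iff (K : Gadget q m d) : K.IsPlanar ↔
    ∃ o, CyclicallyPlanar ⊥ (vertexRotation K.sig o) (fun x => K.inc x.1 x.2) K.boundary := by
  have h1 : K.IsPlanar ↔ ∃ o, IsPlanarPartition (K.rotC o) (Setoid.comap K.endE ⊥) := by
    refine exists_congr fun o => exists_congr fun τ => and_congr_left fun _ => ?_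
    rw [Setoid.ext_iff]
    rfl
  rw [h1]
  refine exists_congr fun o => ?_
  rw [cyclicallyPlanar_iff (Fin.append K.out (K.inp ∘ Fin.rev))
    (by rw [List.ofFn_fin_append, boundary, reverse_ofFn])]
  let e : K.Edge ≃ (Σ c, Fin (K.sig c).arity) ⊕ Fin (m + d) :=
    (Equiv.refl _).sumCongr (((Equiv.refl (Fin m)).sumCongr Fin.revPerm).trans finSumFinEquiv)
  have h2 : ∀ x, e (K.rotC o x) = Perm.sumCongr (vertexRotation K.sig o) (finRotate (m + d)) (e x) := by
    rintro (x | x)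
    · rfl
    · simp only [e, rotC, danglingRotation, Perm.sumCongr_apply, Sum.map_inr, Equiv.sumCongr_apply,
        Equiv.permCongr_apply, Equiv.symm_symm, Equiv.apply_symm_apply]
  have h3 : ∀ x y, Setoid.comap K.endE ⊥ x y ↔
      Setoid.comap (Sum.elim (fun x => K.inc x.1 x.2) (Fin.append K.out (K.inp ∘ Fin.rev))) ⊥
        (e x) (e y) := by
    have h4 : ∀ x, Sum.elim (fun x => K.inc x.1 x.2) (Fin.append K.out (K.inp ∘ Fin.rev)) (e x)
        = K.endE x := by
      rintro (x | x | x) <;> simp [e, endE]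
    exact fun x y => ⟨fun h => (h4 x).trans (Eq.trans h (h4 y).symm),
      fun h => (h4 x).symm.trans (Eq.trans h (h4 y))⟩
  constructor
  · exact fun h => h.transport e h2 h3
  · refine fun h => h.transport e.symm (fun x => ?_) (fun x y => ?_)
    · rw [Equiv.symm_apply_eq, h2, e.apply_symm_apply]
    · rw [h3, e.apply_symm_apply, e.apply_symm_apply]

instance (K : Gadget q m d) : Finite (Σ c, Fin (K.sig c).arity) := by
  have := K.finite_C
  infer_instance

theorem IsPlanar.of_iso {K L : Gadget q m d} (h : K.IsPlanar) (e : K.Iso L) : L.IsPlanar := by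
  rw [isPlanar_iff] at h ⊢
  obtain ⟨o, h⟩ := h
  refine ⟨o ∘ e.onC.symm, ?_⟩
  have hb : L.boundary = K.boundary.map e.onE := by
    simp only [boundary, List.map_append, List.map_reverse, List.map_ofFn]
    rw [show L.out = e.onE ∘ K.out from funext e.out_eq,
      show L.inp = e.onE ∘ K.inp from funext e.inp_eq]
  rw [hb]
  refine h.map_bot (Equiv.sigmaCongr e.onC fun c =>
    finCongr (congrArg ConstraintFunction.arity (e.sig_eq c)).symm) ?_ _
    (fun x y => e.onE.injective.eq_iff.symm) ?_
  · rintro ⟨c, i⟩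
    rw [vertexRotation_apply]
    refine Sigma.ext rfl (heq_of_eq ?_)
    have hc := (congrArg ConstraintFunction.arity (e.sig_eq c)).symm
    change Fin.cast hc (orientedRotation (o c) _ i)
      = orientedRotation (o (e.onC.symm (e.onC c))) _ (Fin.cast hc i)
    rw [e.onC.symm_apply_apply]
    exact cast_orientedRotation _ _ _
  · rintro ⟨c, i⟩
    exact e.inc_eq c i

theorem IsPlanar.dagger {K : Gadget q m d} (h : K.IsPlanar) : K.dagger.IsPlanar := by
  rw [isPlanar_iff] at h ⊢
  obtain ⟨o, h⟩ := h
  refine ⟨fun c => !o c, ?_⟩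
  have hb : List.ofFn K.inp ++ (List.ofFn K.out).reverse = K.boundary.reverse := by
    simp [boundary]
  have hr : vertexRotation (fun c => (K.sig c).conj) (fun c => !o c)
      = (vertexRotation K.sig o)⁻¹ := by
    refine Equiv.ext fun ⟨c, i⟩ => ?_
    change (⟨c, orientedRotation (!o c) (K.sig c).arity i⟩ : Σ c, Fin (K.sig c).arity)
      = ⟨c, (orientedRotation (o c) (K.sig c).arity)⁻¹ i⟩
    rw [orientedRotation_not]
  have h1 := h.reverse
  rw [← hb, ← hr] at h1
  exact h1

theorem sumSetoid_bot {X Y : Type} : sumSetoid (⊥ : Setoid X) (⊥ : Setoid Y) = ⊥ := by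
  ext x y
  rcases x with x | x <;> rcases y with y | y <;> simp

theorem vertexRotation_sum {C C' : Type} {sig : C → ConstraintFunction q}
    {sig' : C' → ConstraintFunction q} {o : C → Bool} {o' : C' → Bool} (x) :
    (Equiv.sumSigmaDistrib _).symm
        (Perm.sumCongr (vertexRotation sig o) (vertexRotation sig' o') x)
      = vertexRotation (Sum.elim sig sig') (Sum.elim o o')
        ((Equiv.sumSigmaDistrib fun c => Fin (Sum.elim sig sig' c).arity).symm x) := by
  rcases x with ⟨c, i⟩ | ⟨c, i⟩ <;> rfl

theorem IsPlanar.tensor {m' d' : ℕ} {K : Gadget q m d} {L : Gadget q m' d'} (hK : K.IsPlanar)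
    (hL : L.IsPlanar) : (K.tensor L).IsPlanar := by
  rw [isPlanar_iff] at hK hL ⊢
  obtain ⟨o, hK⟩ := hK
  obtain ⟨o', hL⟩ := hL
  refine ⟨Sum.elim o o', ?_⟩
  -- The boundary of the tensor product is that of `K` with the boundary of `L` inserted between
  -- outputs and inputs; rotating `K` first puts this gap at the end of the list.
  have h1 := (CyclicallyPlanar.append_comm hK).union hL
  have hb : @Eq (List (K.E ⊕ L.E)) (K.tensor L).boundary ((List.ofFn K.out).map Sum.inl ++
      (L.boundary.map Sum.inr ++ (List.ofFn K.inp).reverse.map Sum.inl)) := by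
    change List.ofFn (Fin.append (Sum.inl ∘ K.out) (Sum.inr ∘ L.out)) ++
      (List.ofFn (Fin.append (Sum.inl ∘ K.inp) (Sum.inr ∘ L.inp))).reverse = _
    simp [boundary, List.ofFn_fin_append]
  rw [List.map_append, List.append_assoc] at h1
  have h2 := CyclicallyPlanar.append_comm h1
  rw [List.append_assoc] at h2
  have h3 := h2.map_bot (Equiv.sumSigmaDistrib fun c => Fin (Sum.elim K.sig L.sig c).arity).symm
    vertexRotation_sum (E' := K.E ⊕ L.E) id
    (u' := fun x => (K.tensor L).inc x.1 x.2) (fun x y => by rw [sumSetoid_bot]; rfl)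
    (by rintro (⟨c, i⟩ | ⟨c, i⟩) <;> rfl)
  rw [List.map_id, ← hb] at h3
  exact h3

theorem IsPlanar.comp {w : ℕ} {K : Gadget q m d} {L : Gadget q d w} (hK : K.IsPlanar)
    (hL : L.IsPlanar) : (K.comp L).IsPlanar := by
  rw [isPlanar_iff] at hK hL ⊢
  obtain ⟨o, hK⟩ := hK
  obtain ⟨o', hL⟩ := hL
  refine ⟨Sum.elim o o', ?_⟩
  -- In the joint boundary the reversed inputs of `K` are directly followed by the outputs of `L`,
  -- the nested pattern that `contract_list` expects.
  have h1 := hK.union hL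
  let P : List ((K.E ⊕ L.E) × (K.E ⊕ L.E)) :=
    List.ofFn fun j => (Sum.inl (K.inp j), Sum.inr (L.out j))
  have hP₁ : P.map Prod.fst = (List.ofFn K.inp).map Sum.inl := by
    simp only [P, List.map_ofFn]; rfl
  have hP₂ : P.map Prod.snd = (List.ofFn L.out).map Sum.inr := by
    simp only [P, List.map_ofFn]; rfl
  rw [boundary, boundary, List.map_append, List.map_append, List.append_assoc] at h1
  have h2 := CyclicallyPlanar.append_comm h1
  rw [List.append_assoc, List.append_assoc, List.map_reverse, ← hP₁, ← hP₂] at h2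
  have h3 := CyclicallyPlanar.append_comm h2.contract_list
  have hb : @Eq (List (Quot (Glue K L))) (K.comp L).boundary (((List.ofFn K.out).map Sum.inl ++
      (List.ofFn L.inp).reverse.map Sum.inr).map (Quot.mk (Glue K L))) := by
    change List.ofFn (Quot.mk (Glue K L) ∘ Sum.inl ∘ K.out) ++
      (List.ofFn (Quot.mk (Glue K L) ∘ Sum.inr ∘ L.inp)).reverse = _
    simp only [List.map_append, List.map_reverse, List.map_ofFn]
  suffices hker : ∀ x y, mergeList (sumSetoid ⊥ ⊥) P x y ↔
      Quot.mk (Glue K L) x = Quot.mk (Glue K L) y by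
    have h4 := h3.map_bot
      (Equiv.sumSigmaDistrib fun c => Fin (Sum.elim K.sig L.sig c).arity).symm vertexRotation_sum
      (E' := Quot (Glue K L)) (Quot.mk (Glue K L)) (u' := fun x => (K.comp L).inc x.1 x.2) hker
      (by rintro (⟨c, i⟩ | ⟨c, i⟩) <;> rfl)
    rw [← hb] at h4
    exact h4
  have hle : mergeList (sumSetoid ⊥ ⊥) P ≤ Setoid.ker (Quot.mk (Glue K L)) := by
    rw [mergeList_le_iff, sumSetoid_bot]
    refine ⟨bot_le, fun p hp => ?_⟩
    obtain ⟨j, rfl⟩ := (List.mem_ofFn' _ _).1 hp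
    exact Quot.sound (Glue.glue j)
  have hge := mergeList_le_iff.1 (le_refl (mergeList (sumSetoid (⊥ : Setoid K.E) (⊥ : Setoid L.E)) P))
  intro x y
  refine ⟨fun h => hle h, fun h => ?_⟩
  have h' := Quot.eqvGen_exact h
  clear h
  induction h' with
  | rel x y h =>
    obtain ⟨j⟩ := h
    exact hge.2 (Sum.inl (K.inp j), Sum.inr (L.out j)) ((List.mem_ofFn' _ _).2 ⟨j, rfl⟩)
  | refl x => exact Setoid.refl' _ x
  | symm x y _ ih => exact Setoid.symm' _ ih
  | trans x y z _ _ ih ih' => exact Setoid.trans' _ ih ih'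

end

end Gadget

namespace Gadget

open Equiv

/-! ### Planarity of the generators -/

/-- Every edge is a face of its own, and each cycle of `σ` is a component with one vertex in either
part. -/
theorem isPlanarRotation_inv_self {X : Type} (σ : Perm X) : IsPlanarRotation σ σ⁻¹ := by
  have h1 : cycleSetoid (1 : Perm X) = ⊥ := le_bot_iff.1 (cycleSetoid_le fun x => rfl)
  rw [isPlanarRotation_iff, orbitSetoid, cycleSetoid_inv, sup_idem, inv_mul_cancel, h1,
    numClasses_of_ker (r := (⊥ : Setoid X)) id Function.surjective_id fun _ _ => Iff.rfl]
  omega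

theorem cycleSetoid_finRotate (n : ℕ) : cycleSetoid (finRotate n) = ⊤ := by
  refine top_le_iff.1 fun i j _ => ?_
  match n, i, j with
  | 0, i, _ => exact i.elim0
  | 1, i, j => rw [Subsingleton.elim i j]
  | n + 2, i, j =>
    have h : ∀ k, finRotate (n + 2) k ≠ k := fun k => by
      rw [← Perm.mem_support, support_finRotate]
      exact Finset.mem_univ k
    exact isCycle_finRotate.sameCycle (h i) (h j)

theorem isPlanar_eqGadget (q m d : ℕ) : (eqGadget q m d).IsPlanar := by
  rw [isPlanar_iff]
  refine ⟨fun _ => true, (Perm.sumCongr _ (finRotate _))⁻¹, ?_, isPlanarRotation_inv_self _⟩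
  rw [cycleSetoid_inv, cycleSetoid_sumCongr, cycleSetoid_finRotate]
  ext x y
  rcases x with ⟨⟨⟩, _⟩ | x
  rcases y with ⟨⟨⟩, _⟩ | y
  rw [sumSetoid_inr]
  exact ⟨fun _ => rfl, fun _ => trivial⟩

theorem cycleSetoid_of_involution {n : ℕ} {π : Perm (Fin n ⊕ Fin n)} (g : Perm (Fin n))
    (h₁ : ∀ i, π (Sum.inr i) = Sum.inl (g i)) (h₂ : ∀ i, π (Sum.inl (g i)) = Sum.inr i) :
    cycleSetoid π = Setoid.ker (Sum.elim id g) := by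
  apply le_antisymm
  · refine cycleSetoid_le ?_
    rintro (i | i)
    · obtain ⟨i, rfl⟩ := g.surjective i
      rw [h₂]
      rfl
    · rw [h₁]
      rfl
  · have h3 : ∀ x, cycleSetoid π x (Sum.inl (Sum.elim id g x)) := by
      rintro (i | i)
      · exact Setoid.refl' _ _
      · have := cycleSetoid_apply (π := π) (Sum.inr i)
        rwa [h₁] at this
    intro x y hxy
    have hxy' : Sum.elim id g x = Sum.elim id g y := hxy
    refine Setoid.trans' _ (h3 x) ?_
    rw [hxy']
    exact Setoid.symm' _ (h3 y)

theorem numClasses_ker_elim {n : ℕ} (g : Perm (Fin n)) :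
    numClasses (Setoid.ker (Sum.elim id g)) = n := by
  rw [numClasses_of_ker (Sum.elim id g) (fun i => ⟨Sum.inl i, rfl⟩) fun _ _ => Iff.rfl,
    Nat.card_fin]

theorem numClasses_top {X : Type} [Nonempty X] : numClasses (⊤ : Setoid X) = 1 := by
  rw [numClasses_of_ker (fun _ => ()) (fun _ => ⟨Classical.arbitrary X, rfl⟩), Nat.card_unique]
  exact fun _ _ => ⟨fun _ => rfl, fun _ => trivial⟩

/-- Two vertices of opposite rotation are joined by `n` paths through binary vertices. There are
also `n` faces, one between consecutive paths, and one component: `2 + n + n = 2 * n + 2`. -/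
theorem isPlanarPartition_double {n : ℕ} (hn : 1 ≤ n) :
    IsPlanarPartition (Perm.sumCongr (finRotate n)⁻¹ (finRotate n))
      (Setoid.ker (Sum.elim id id : Fin n ⊕ Fin n → Fin n)) := by
  have : Nonempty (Fin n) := ⟨⟨0, hn⟩⟩
  have h1 : cycleSetoid (Equiv.sumComm (Fin n) (Fin n) : Perm (Fin n ⊕ Fin n))
      = Setoid.ker (Sum.elim id id) := cycleSetoid_of_involution 1 (fun _ => rfl) (fun _ => rfl)
  refine ⟨Equiv.sumComm _ _, h1, ?_⟩
  have h2 : cycleSetoid ((Equiv.sumComm (Fin n) (Fin n) : Perm (Fin n ⊕ Fin n)) *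
      Perm.sumCongr (finRotate n)⁻¹ (finRotate n)) = Setoid.ker (Sum.elim id (finRotate n)) :=
    cycleSetoid_of_involution (finRotate n) (fun _ => rfl) (fun i => by
      simp [-finRotate_apply])
  have h3 : orbitSetoid (Perm.sumCongr (finRotate n)⁻¹ (finRotate n)) (Equiv.sumComm _ _) = ⊤ := by
    rw [orbitSetoid, cycleSetoid_sumCongr, cycleSetoid_inv, cycleSetoid_finRotate, h1]
    set r := sumSetoid (⊤ : Setoid (Fin n)) (⊤ : Setoid (Fin n)) ⊔
      Setoid.ker (Sum.elim id id : Fin n ⊕ Fin n → Fin n)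
    have h4 : ∀ i j, r (Sum.inl i) (Sum.inl j) := fun i j =>
      (le_sup_left : sumSetoid ⊤ ⊤ ≤ r) (sumSetoid_inl.2 trivial)
    have h5 : ∀ x, r x (Sum.inl (Sum.elim id id x)) := fun x =>
      (le_sup_right : Setoid.ker (Sum.elim id id) ≤ r) rfl
    refine top_le_iff.1 fun x y _ => ?_
    exact Setoid.trans' _ (h5 x) (Setoid.trans' _ (h4 _ _) (Setoid.symm' _ (h5 y)))
  have h6 := numClasses_ker_elim (1 : Perm (Fin n))
  rw [Perm.coe_one] at h6
  rw [isPlanarRotation_iff, h3, h2, h1, numClasses_ker_elim, cycleSetoid_sumCongr, cycleSetoid_inv,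
    cycleSetoid_finRotate, numClasses_sumSetoid, numClasses_top, numClasses_top, h6, Nat.card_sum,
    Nat.card_fin]
  omega

theorem isPlanar_sigGadget {q : ℕ} (F : ConstraintFunction q) : (sigGadget F).IsPlanar := by
  rw [isPlanar_iff]
  refine ⟨fun _ => false, ?_⟩
  refine (cyclicallyPlanar_iff (E := Fin F.arity) (n := F.arity) id (by
    exact List.append_nil (List.ofFn (n := F.arity) id))).2 ?_
  refine (isPlanarPartition_double F.arity_pos).transport
    (((Equiv.uniqueSigma fun _ : Unit => Fin F.arity).symm).sumCongr (Equiv.refl _)) ?_ ?_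
  · rintro (i | i) <;> rfl
  · rintro (i | i) (j | j) <;> rfl

/-- All generated gadgets are planar and in the context of `𝓕`. -/
theorem mem_planarGadgets_of_inClosure {q m d : ℕ} {𝓕 : Set (ConstraintFunction q)}
    (h𝓕 : ConjugateClosed 𝓕) {K : Gadget q m d} (h : InClosure (generators 𝓕) m d K) :
    K ∈ planarGadgets 𝓕 m d := by
  induction h with
  | of h =>
    cases h with
    | e10 => exact ⟨fun c => c.elim, isPlanar_eqGadget _ _ _⟩
    | e12 => exact ⟨fun c => c.elim, isPlanar_eqGadget _ _ _⟩
    | sig F hF => exact ⟨fun _ => hF, isPlanar_sigGadget F⟩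
  | comp _ _ hK hL =>
    refine ⟨?_, hK.2.comp hL.2⟩
    rintro (c | c)
    · exact hK.1 c
    · exact hL.1 c
  | tensor _ _ hK hL =>
    refine ⟨?_, hK.2.tensor hL.2⟩
    rintro (c | c)
    · exact hK.1 c
    · exact hL.1 c
  | dagger _ hK => exact ⟨fun c => (h𝓕 _).1 (hK.1 c), hK.2.dagger⟩
  | iso e _ hK =>
    refine ⟨fun c => ?_, hK.2.of_iso e⟩
    obtain ⟨c, rfl⟩ := e.onC.surjective c
    rw [e.sig_eq]
    exact hK.1 c

end Gadget


/-! ### Generated gadgets with dangling edges given by lists -/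

/-- A gadget without dangling edges, whose vertices may be used as ends of dangling edges. -/
structure Body (q : ℕ) where
  E : Type
  C : Type
  finite_E : Finite E
  finite_C : Finite C
  nonempty_E : Nonempty E
  sig : C → ConstraintFunction q
  inc : (c : C) → Fin (sig c).arity → E

namespace Body

variable {q : ℕ}

/-- Attaching dangling edges. -/
abbrev gadget (D : Body q) {m d : ℕ} (out : Fin m → D.E) (inp : Fin d → D.E) : Gadget q m d where
  E := D.E
  C := D.C
  finite_E := D.finite_E
  finite_C := D.finite_C
  nonempty_E := D.nonempty_E
  sig := D.sig
  inc := D.inc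
  out := out
  inp := inp

/-- Isomorphism of gadgets without dangling edges. -/
structure Iso (D D' : Body q) where
  onE : D.E ≃ D'.E
  onC : D.C ≃ D'.C
  sig_eq : ∀ c, D'.sig (onC c) = D.sig c
  inc_eq : ∀ c i,
    D'.inc (onC c) (Fin.cast (congrArg ConstraintFunction.arity (sig_eq c)).symm i)
      = onE (D.inc c i)

/-- The disjoint union. -/
abbrev sum (D D' : Body q) : Body q where
  E := D.E ⊕ D'.E
  C := D.C ⊕ D'.C
  finite_E := by
    have := D.finite_E
    have := D'.finite_E
    infer_instance
  finite_C := by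
    have := D.finite_C
    have := D'.finite_C
    infer_instance
  nonempty_E := D.nonempty_E.map Sum.inl
  sig := Sum.elim D.sig D'.sig
  inc := fun c => match c with
    | Sum.inl c => fun i => Sum.inl (D.inc c i)
    | Sum.inr c => fun i => Sum.inr (D'.inc c i)

/-- The constraint vertices of `D` and `D'`, attached to the vertices in `T`. -/
abbrev amalgam (D D' : Body q) {T : Type} [Finite T] [Nonempty T] (f : D.E → T) (f' : D'.E → T) :
    Body q where
  E := T
  C := D.C ⊕ D'.C
  finite_E := inferInstance
  finite_C := by
    have := D.finite_C
    have := D'.finite_C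
    infer_instance
  nonempty_E := inferInstance
  sig := Sum.elim D.sig D'.sig
  inc := fun c => match c with
    | Sum.inl c => fun i => f (D.inc c i)
    | Sum.inr c => fun i => f' (D'.inc c i)

/-- The complex conjugate. -/
abbrev conj (D : Body q) : Body q where
  E := D.E
  C := D.C
  finite_E := D.finite_E
  finite_C := D.finite_C
  nonempty_E := D.nonempty_E
  sig := fun c => (D.sig c).conj
  inc := fun c i => D.inc c i

/-- A single equality vertex. -/
abbrev single (q : ℕ) : Body q where
  E := Unit
  C := Empty
  finite_E := inferInstance
  finite_C := inferInstance
  nonempty_E := inferInstance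
  sig := fun c => c.elim
  inc := fun c => c.elim

/-- Adding `n` isolated equality vertices. -/
abbrev pad (D : Body q) (n : ℕ) : Body q where
  E := D.E ⊕ Fin n
  C := D.C
  finite_E := by
    have := D.finite_E
    infer_instance
  finite_C := D.finite_C
  nonempty_E := D.nonempty_E.map Sum.inl
  sig := D.sig
  inc := fun c i => Sum.inl (D.inc c i)

end Body

/-- `D` with outputs at `o` and inputs at `i` is generated. -/
def Generated {q : ℕ} (𝓕 : Set (ConstraintFunction q)) (D : Body q) (o i : List D.E) : Prop :=
  InClosure (generators 𝓕) o.length i.length (D.gadget o.get i.get)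

namespace Generated

variable {q : ℕ} {𝓕 : Set (ConstraintFunction q)} {D D' : Body q}

theorem iff_inClosure {m d : ℕ} {o i : List D.E} (out : Fin m → D.E) (inp : Fin d → D.E)
    (ho : o = List.ofFn out) (hi : i = List.ofFn inp) :
    Generated 𝓕 D o i ↔ InClosure (generators 𝓕) m d (D.gadget out inp) := by
  have hm : o.length = m := by simp [ho]
  have hd : i.length = d := by simp [hi]
  subst hm
  subst hd
  have h1 : out = o.get := List.ofFn_injective (by rw [← ho, List.ofFn_get])
  have h2 : inp = i.get := List.ofFn_injective (by rw [← hi, List.ofFn_get])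
  subst h1
  subst h2
  rfl

theorem iso {o i : List D.E} (h : Generated 𝓕 D o i) (e : D.Iso D') {o' i' : List D'.E}
    (ho : o' = o.map e.onE) (hi : i' = i.map e.onE) : Generated 𝓕 D' o' i' := by
  rw [iff_inClosure (e.onE ∘ o.get) (e.onE ∘ i.get) (by rw [ho, ← List.map_ofFn, List.ofFn_get])
    (by rw [hi, ← List.map_ofFn, List.ofFn_get])]
  exact InClosure.iso ⟨e.onE, e.onC, e.sig_eq, e.inc_eq, fun _ => rfl, fun _ => rfl⟩ h

theorem tensor {o i : List D.E} {o' i' : List D'.E} (h : Generated 𝓕 D o i)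
    (h' : Generated 𝓕 D' o' i') :
    Generated 𝓕 (D.sum D') (o.map Sum.inl ++ o'.map Sum.inr : List (D.E ⊕ D'.E))
      (i.map Sum.inl ++ i'.map Sum.inr : List (D.E ⊕ D'.E)) := by
  have key : ∀ (o : List D.E) (o' : List D'.E), (o.map Sum.inl ++ o'.map Sum.inr : List (D.E ⊕ D'.E))
      = List.ofFn (Fin.append (Sum.inl ∘ o.get) (Sum.inr ∘ o'.get)) := fun o o' => by
    rw [List.ofFn_fin_append, ← List.map_ofFn, ← List.map_ofFn, List.ofFn_get, List.ofFn_get]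
  have e : ((D.gadget o.get i.get).tensor (D'.gadget o'.get i'.get)).Iso
      ((D.sum D').gadget (Fin.append (Sum.inl ∘ o.get) (Sum.inr ∘ o'.get))
        (Fin.append (Sum.inl ∘ i.get) (Sum.inr ∘ i'.get))) :=
    ⟨Equiv.refl _, Equiv.refl _, fun _ => rfl, by rintro (c | c) j <;> rfl, fun _ => rfl,
      fun _ => rfl⟩
  exact (iff_inClosure (D := D.sum D') _ _ (key o o') (key i i')).2
    (InClosure.iso e (InClosure.tensor h h'))

theorem dagger {o i : List D.E} (h : Generated 𝓕 D o i) : Generated 𝓕 D.conj i o :=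
  InClosure.dagger h

theorem conj_conj (F : ConstraintFunction q) : F.conj.conj = F := by
  simp [ConstraintFunction.conj]

theorem of_conj {o i : List D.E} (h : Generated 𝓕 D.conj o i) : Generated 𝓕 D i o :=
  h.dagger.iso (D := D.conj.conj) ⟨Equiv.refl D.E, Equiv.refl D.C, fun _ => (conj_conj _).symm,
    fun _ _ => rfl⟩ (List.map_id _).symm (List.map_id _).symm

/-- Composition, where `T` is a pushout of the two sets of equality vertices. -/
theorem comp {o A : List D.E} {B i : List D'.E} (h : Generated 𝓕 D o A) (h' : Generated 𝓕 D' B i)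
    {T : Type} [Finite T] [Nonempty T] (f : D.E → T) (f' : D'.E → T) (hAB : A.map f = B.map f')
    (s : T → D.E ⊕ D'.E) (hs : ∀ t, Sum.elim f f' (s t) = t)
    (hs' : ∀ (Q : Type) (g : D.E → Q) (g' : D'.E → Q), A.map g = B.map g' →
      ∀ x, Sum.elim g g' (s (Sum.elim f f' x)) = Sum.elim g g' x) :
    Generated 𝓕 (D.amalgam D' f f') (o.map f) (i.map f') := by
  obtain ⟨d, a, rfl⟩ : ∃ (d : ℕ) (a : Fin d → D.E), A = List.ofFn a :=
    ⟨_, _, (List.ofFn_get A).symm⟩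
  obtain ⟨d', b, rfl⟩ : ∃ (d : ℕ) (b : Fin d → D'.E), B = List.ofFn b :=
    ⟨_, _, (List.ofFn_get B).symm⟩
  have hd : d = d' := by simpa using congrArg List.length hAB
  subst hd
  rw [List.map_ofFn, List.map_ofFn, List.ofFn_inj] at hAB
  rw [iff_inClosure o.get a (List.ofFn_get o).symm rfl] at h
  rw [iff_inClosure b i.get rfl (List.ofFn_get i).symm] at h'
  rw [iff_inClosure (D := D.amalgam D' f f') (f ∘ o.get) (f' ∘ i.get)
    (by rw [← List.map_ofFn, List.ofFn_get]) (by rw [← List.map_ofFn, List.ofFn_get])]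
  let R := Gadget.Glue (D.gadget o.get a) (D'.gadget b i.get)
  have hR : ∀ x y, R x y → Sum.elim f f' x = Sum.elim f f' y := by
    rintro _ _ ⟨j⟩
    exact congrFun hAB j
  -- The glued vertex set is itself a cocone, so `hs'` shows that the section `s` induces the
  -- inverse of the map from it to `T`.
  have hQ := hs' (Quot R) (fun x => Quot.mk R (Sum.inl x)) (fun x => Quot.mk R (Sum.inr x)) (by
    rw [List.map_ofFn, List.map_ofFn, List.ofFn_inj]
    exact funext fun j => Quot.sound (Gadget.Glue.glue j))
  have hQ' : ∀ x : D.E ⊕ D'.E, Sum.elim (fun x => Quot.mk R (Sum.inl x))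
      (fun x => Quot.mk R (Sum.inr x)) x = Quot.mk R x := by
    rintro (x | x) <;> rfl
  have e : ((D.gadget o.get a).comp (D'.gadget b i.get)).Iso
      ((D.amalgam D' f f').gadget (f ∘ o.get) (f' ∘ i.get)) := by
    refine ⟨⟨Quot.lift (Sum.elim f f') hR, fun t => Quot.mk R (s t), ?_, fun t => hs t⟩,
      Equiv.refl _, fun _ => rfl, ?_, fun _ => rfl, fun _ => rfl⟩
    · rintro ⟨x⟩
      have := hQ x
      rw [hQ', hQ'] at this
      exact this
    · rintro (c | c) j <;> rfl
  exact InClosure.iso e (InClosure.comp h h')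

/-! ### Equality gadgets -/

/-- At least one edge must be joined, since otherwise the two equality vertices would remain
separate. -/
theorem single_comp {o A B i : List Unit} (h : Generated 𝓕 (Body.single q) o A)
    (h' : Generated 𝓕 (Body.single q) B i) (hAB : A.length = B.length) (hA : A ≠ []) :
    Generated 𝓕 (Body.single q) o i := by
  have key : A.map id = B.map id := by
    rw [List.map_id, List.map_id]
    exact List.ext_getElem hAB fun _ _ _ => rfl
  refine (h.comp h' (T := Unit) id id key (fun _ => Sum.inl ()) (fun _ => rfl) ?_).iso
    (D' := Body.single q) ⟨Equiv.refl _, Equiv.sumEmpty Empty Empty, ?_, ?_⟩ ?_ ?_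
  · intro Q g g' hg
    obtain ⟨a, A, rfl⟩ := List.exists_cons_of_ne_nil hA
    obtain ⟨b, B, rfl⟩ := List.exists_cons_of_ne_nil
      (show B ≠ [] by rintro rfl; simp at hAB)
    rintro (x | x)
    · rfl
    · exact (List.cons.inj hg).1
  · rintro (⟨⟨⟩⟩ | ⟨⟨⟩⟩)
  · rintro (⟨⟨⟩⟩ | ⟨⟨⟩⟩)
  · exact (by simp : o = List.map id (List.map id o))
  · exact (by simp : i = List.map id (List.map id i))

theorem single_one_zero : Generated 𝓕 (Body.single q) [()] [] :=
  InClosure.of IsGenerator.e10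

theorem single_one_two : Generated 𝓕 (Body.single q) [()] [(), ()] :=
  InClosure.of IsGenerator.e12

/-- `E^{1,1}` is `E^{1,2}` composed with its dagger, and `E^{1,n+1}` is `E^{1,2} ∘ (E^{1,1} ⊗
E^{1,n})`. -/
theorem single_one (n : ℕ) : Generated 𝓕 (Body.single q) [()] (List.replicate n ()) := by
  have h21 : Generated 𝓕 (Body.single q) [(), ()] [()] := of_conj
    (single_one_two.iso (D' := (Body.single q).conj)
      ⟨Equiv.refl _, Equiv.refl _, fun c => c.elim, fun c => c.elim⟩ rfl rfl)
  have h11 : Generated 𝓕 (Body.single q) [()] [()] :=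
    single_one_two.single_comp h21 rfl (List.cons_ne_nil _ _)
  induction n with
  | zero => exact single_one_zero
  | succ n ih =>
    refine (single_one_two.comp (h11.tensor ih) (T := Unit) id (fun _ => ()) rfl
      (fun _ => Sum.inl ()) (fun _ => rfl) ?_).iso
      (D' := Body.single q) ⟨Equiv.refl _, Equiv.equivOfIsEmpty (Empty ⊕ (Empty ⊕ Empty)) Empty,
        ?_, ?_⟩ rfl ?_
    · intro Q g g' hg
      rintro (⟨⟩ | ⟨⟩ | ⟨⟩)
      · rfl
      · exact (List.cons.inj hg).1
      · exact (List.cons.inj (List.cons.inj hg).2).1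
    · rintro (⟨⟨⟩⟩ | ⟨⟨⟩⟩ | ⟨⟨⟩⟩)
    · rintro (⟨⟨⟩⟩ | ⟨⟨⟩⟩ | ⟨⟨⟩⟩)
    · exact List.ext_getElem (by simp) fun _ _ _ => rfl

theorem single (o i : List Unit) : Generated 𝓕 (Body.single q) o i := by
  have h1 : ∀ l : List Unit, l = List.replicate l.length () := fun l =>
    List.ext_getElem (by simp) fun _ _ _ => rfl
  rw [h1 o, h1 i]
  have h2 : Generated 𝓕 (Body.single q) (List.replicate o.length ()) [()] := of_conj
    ((single_one o.length).iso (D' := (Body.single q).conj)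
      ⟨Equiv.refl _, Equiv.refl _, fun c => c.elim, fun c => c.elim⟩ rfl (List.map_id _).symm)
  exact h2.single_comp (single_one i.length) rfl (List.cons_ne_nil _ _)

/-! ### Padding, bending and rotating -/

/-- The `n` new vertices are copies of `E^{1,1}`: wires that carry other dangling edges past `D` in
a composition. -/
theorem padLeft {o i : List D.E} (h : Generated 𝓕 D o i) (n : ℕ) :
    Generated 𝓕 (D.pad n) ((List.finRange n).map Sum.inr ++ o.map Sum.inl : List (D.E ⊕ Fin n))
      ((List.finRange n).map Sum.inr ++ i.map Sum.inl : List (D.E ⊕ Fin n)) := by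
  induction n with
  | zero =>
    exact h.iso ⟨(Equiv.sumEmpty D.E (Fin 0)).symm, Equiv.refl _, fun _ => rfl, fun _ _ => rfl⟩ (D' := D.pad 0)
      rfl rfl
  | succ n ih =>
    let e : Unit ⊕ (D.E ⊕ Fin n) ≃ D.E ⊕ Fin (n + 1) :=
      Equiv.ofBijective (Sum.elim (fun _ => Sum.inr 0) (Sum.map id Fin.succ)) (by
        constructor
        · rintro (x | x | x) (y | y | y) hxy <;> simp [Fin.ext_iff] at hxy ⊢
          · exact hxy
          · exact hxy
        · rintro (x | x)
          · exact ⟨Sum.inr (Sum.inl x), rfl⟩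
          · cases x using Fin.cases with
            | zero => exact ⟨Sum.inl (), rfl⟩
            | succ x => exact ⟨Sum.inr (Sum.inr x), rfl⟩)
    have key : ∀ o : List D.E, ((List.finRange (n + 1)).map Sum.inr ++ o.map Sum.inl :
        List (D.E ⊕ Fin (n + 1))) = ([()].map Sum.inl ++
        ((List.finRange n).map Sum.inr ++ o.map Sum.inl).map Sum.inr :
        List (Unit ⊕ (D.E ⊕ Fin n))).map e := fun o => by
      simp only [List.finRange_succ, List.map_append, List.map_cons, List.map_map, List.map_nil,
        List.cons_append, List.nil_append]
      rfl
    exact ((Generated.single [()] [()]).tensor ih).iso (D' := D.pad (n + 1))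
      ⟨e, Equiv.emptySum Empty D.C, by rintro (⟨⟨⟩⟩ | c); rfl, by rintro (⟨⟨⟩⟩ | c) _; rfl⟩
      (key o) (key i)

theorem padRight {o i : List D.E} (h : Generated 𝓕 D o i) (n : ℕ) :
    Generated 𝓕 (D.pad n) (o.map Sum.inl ++ (List.finRange n).map Sum.inr : List (D.E ⊕ Fin n))
      (i.map Sum.inl ++ (List.finRange n).map Sum.inr : List (D.E ⊕ Fin n)) := by
  induction n with
  | zero =>
    exact h.iso (D' := D.pad 0)
      ⟨(Equiv.sumEmpty D.E (Fin 0)).symm, Equiv.refl _, fun _ => rfl, fun _ _ => rfl⟩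
      (List.append_nil _) (List.append_nil _)
  | succ n ih =>
    let e : (D.E ⊕ Fin n) ⊕ Unit ≃ D.E ⊕ Fin (n + 1) :=
      Equiv.ofBijective (Sum.elim (Sum.map id Fin.castSucc) (fun _ => Sum.inr (Fin.last n))) (by
        constructor
        · rintro ((x | x) | x) ((y | y) | y) hxy <;> simp [Fin.ext_iff] at hxy ⊢
          · exact hxy
          · exact hxy
          · exact absurd hxy x.isLt.ne
          · exact absurd hxy.symm y.isLt.ne
        · rintro (x | x)
          · exact ⟨Sum.inl (Sum.inl x), rfl⟩
          · cases x using Fin.lastCases with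
            | last => exact ⟨Sum.inr (), rfl⟩
            | cast x => exact ⟨Sum.inl (Sum.inr x), rfl⟩)
    have key : ∀ o : List D.E, (o.map Sum.inl ++ (List.finRange (n + 1)).map Sum.inr :
        List (D.E ⊕ Fin (n + 1))) = ((o.map Sum.inl ++ (List.finRange n).map Sum.inr).map Sum.inl ++
        [()].map Sum.inr : List ((D.E ⊕ Fin n) ⊕ Unit)).map e := fun o => by
      simp only [List.finRange_succ_last, List.map_append, List.map_cons, List.map_map,
        List.map_nil, List.append_assoc]
      rfl
    exact (ih.tensor (Generated.single [()] [()])).iso (D' := D.pad (n + 1))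
      ⟨e, Equiv.sumEmpty D.C Empty, by rintro (c | ⟨⟨⟩⟩); rfl, by rintro (c | ⟨⟨⟩⟩) _; rfl⟩
      (key o) (key i)

/-- The cap `E^{0,2}` joins the last output to a new wire `E^{1,1}` placed below, whose input
thereby becomes an input at `x`. -/
theorem bend {o i : List D.E} {x : D.E} (h : Generated 𝓕 D (o ++ [x]) i) :
    Generated 𝓕 D o (i ++ [x]) := by
  have := D.finite_E
  have := D.nonempty_E
  have hget : (List.finRange o.length).map o.get = o := by
    rw [← List.ofFn_eq_map, List.ofFn_get]
  refine (((Generated.single [] [(), ()]).padLeft o.length).comp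
    (h.tensor (Generated.single [()] [()])) (T := D.E) (Sum.elim (fun _ => x) o.get)
    (Sum.elim id fun _ => x) ?_ (fun t => Sum.inr (Sum.inl t)) (fun _ => rfl) ?_).iso
    (D' := D) ⟨Equiv.refl _, (Equiv.emptySum Empty _).trans (Equiv.sumEmpty D.C Empty),
      ?_, ?_⟩ ?_ ?_
  · simp [Function.comp_def]
  · intro Q g g' hg
    simp only [List.map_append, List.map_map, List.map_cons, List.map_nil, List.append_assoc,
      List.cons_append, List.nil_append] at hg
    obtain ⟨h1, h2⟩ := List.append_inj hg (by simp)
    have h3 := (List.cons.inj h2).1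
    have h4 := (List.cons.inj (List.cons.inj h2).2).1
    have h5 : ∀ j, g (Sum.inr j) = g' (Sum.inl (o.get j)) := by
      have h6 : o.map (g' ∘ Sum.inl) = (List.finRange o.length).map (g' ∘ Sum.inl ∘ o.get) := by
        conv_lhs => rw [← hget]
        rw [List.map_map]
        rfl
      rw [h6] at h1
      exact fun j => List.map_inj_left.1 h1 j (List.mem_finRange j)
    rintro ((⟨⟩ | j) | (t | ⟨⟩))
    · exact h3.symm
    · exact (h5 j).symm
    · rfl
    · exact h3.symm.trans h4
  · rintro (⟨⟨⟩⟩ | c | ⟨⟨⟩⟩); rfl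
  · rintro (⟨⟨⟩⟩ | c | ⟨⟨⟩⟩) _; rfl
  · simp [Function.comp_def]
  · simp [Function.comp_def]

theorem bendTop {o i : List D.E} {x : D.E} (h : Generated 𝓕 D (x :: o) i) :
    Generated 𝓕 D o (x :: i) := by
  have := D.finite_E
  have := D.nonempty_E
  have hget : (List.finRange o.length).map o.get = o := by
    rw [← List.ofFn_eq_map, List.ofFn_get]
  refine (((Generated.single [] [(), ()]).padRight o.length).comp
    ((Generated.single [()] [()]).tensor h) (T := D.E) (Sum.elim (fun _ => x) o.get)
    (Sum.elim (fun _ => x) id) ?_ (fun t => Sum.inr (Sum.inr t)) (fun _ => rfl) ?_).iso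
    (D' := D) ⟨Equiv.refl _, (Equiv.emptySum Empty _).trans (Equiv.emptySum Empty D.C),
      ?_, ?_⟩ ?_ ?_
  · simp [Function.comp_def]
  · intro Q g g' hg
    simp only [List.map_map, List.map_cons, List.map_nil,
      List.cons_append, List.nil_append] at hg
    have h3 := (List.cons.inj hg).1
    have h4 := (List.cons.inj (List.cons.inj hg).2).1
    have h1 := (List.cons.inj (List.cons.inj hg).2).2
    have h5 : ∀ j, g (Sum.inr j) = g' (Sum.inr (o.get j)) := by
      have h6 : o.map (g' ∘ Sum.inr) = (List.finRange o.length).map (g' ∘ Sum.inr ∘ o.get) := by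
        conv_lhs => rw [← hget]
        rw [List.map_map]
        rfl
      rw [h6] at h1
      exact fun j => List.map_inj_left.1 h1 j (List.mem_finRange j)
    rintro ((⟨⟩ | j) | (⟨⟩ | t))
    · exact h4.symm
    · exact (h5 j).symm
    · exact h4.symm.trans h3
    · rfl
  · rintro (⟨⟨⟩⟩ | ⟨⟨⟩⟩ | c); rfl
  · rintro (⟨⟨⟩⟩ | ⟨⟨⟩⟩ | c) _; rfl
  · simp [Function.comp_def]
  · simp [Function.comp_def]

theorem bend_append {o i s : List D.E} (h : Generated 𝓕 D (o ++ s) i) :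
    Generated 𝓕 D o (i ++ s.reverse) := by
  induction s using List.reverseRecOn generalizing i with
  | nil => simpa using h
  | append_singleton s x ih =>
    rw [← List.append_assoc] at h
    simpa using ih h.bend

theorem unbend_append {o i s : List D.E} (h : Generated 𝓕 D o (i ++ s)) :
    Generated 𝓕 D (o ++ s.reverse) i :=
  of_conj (D := D) (bend_append (D := D.conj) h.dagger)

theorem of_isRotated {o o' : List D.E} (h : Generated 𝓕 D o []) (hr : o ~r o') :
    Generated 𝓕 D o' [] := by
  obtain ⟨n, rfl⟩ := hr
  induction n generalizing o with
  | zero => simpa using h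
  | succ n ih =>
    cases o with
    | nil => simpa using h
    | cons a o =>
      rw [List.rotate_cons_succ]
      -- The first output is bent over the top into an input and returned from there under the
      -- bottom as the last output.
      exact ih (unbend_append (i := []) (s := [a]) h.bendTop)

/-! ### Attaching a generated gadget -/

/-- Attaching a gadget, all of whose vertices carry inputs, to the last outputs of another one. -/
theorem attach {o A : List D.E} {ℓ B i : List D'.E} (h : Generated 𝓕 D o A)
    (h' : Generated 𝓕 D' (ℓ ++ B) i) [Finite D'.E] [Nonempty D'.E] (f : D.E → D'.E)
    (hA : ∀ x, x ∈ A) (hAB : A.map f = B) :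
    Generated 𝓕 (D.amalgam D' f id) (ℓ ++ o.map f) i := by
  have hget : (List.finRange ℓ.length).map ℓ.get = ℓ := by
    rw [← List.ofFn_eq_map, List.ofFn_get]
  subst hAB
  -- By `hA` every vertex of `D` is glued to a vertex of `D'`, and so is every wire; hence the
  -- pushout is just `D'.E`, with section `Sum.inr`.
  refine ((h.padLeft ℓ.length).comp h' (T := D'.E) (Sum.elim f ℓ.get) id ?_ Sum.inr
    (fun _ => rfl) ?_).iso
    (D' := D.amalgam D' f id) ⟨Equiv.refl _, Equiv.refl _, ?_, ?_⟩ ?_ ?_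
  · simp [Function.comp_def]
  · intro Q g g' hg
    simp only [List.map_append, List.map_map] at hg
    obtain ⟨h1, h2⟩ := List.append_inj hg (by simp)
    have h5 : ∀ j, g (Sum.inr j) = g' (ℓ.get j) := by
      have h6 : ℓ.map g' = (List.finRange ℓ.length).map (g' ∘ ℓ.get) := by
        conv_lhs => rw [← hget]
        rw [List.map_map]
      rw [h6] at h1
      exact fun j => List.map_inj_left.1 h1 j (List.mem_finRange j)
    rintro ((t | j) | t)
    · exact (List.map_inj_left.1 h2 t (hA t)).symm
    · exact (h5 j).symm
    · rfl
  · rintro (c | c) <;> rfl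
  · rintro (c | c) _ <;> rfl
  · simp [Function.comp_def]
  · simp

end Generated


namespace Gadget

open Equiv

/-! ### Noncrossing partitions -/

theorem exists_fixed_of_card_lt {X : Type} [Finite X] {π : Perm X}
    (h : Nat.card X < 2 * numClasses (cycleSetoid π)) : ∃ x, π x = x := by
  by_contra! hc
  have hout : ∀ q : Quotient (cycleSetoid π), Quotient.mk (cycleSetoid π) (π q.out) = q := fun q => by
    conv_rhs => rw [← q.out_eq]
    exact Quotient.sound (Setoid.symm' _ (cycleSetoid_apply _))
  -- Without fixed points every cycle contributes two different points, a representative and its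
  -- image.
  have hinj : Function.Injective (fun p : Bool × Quotient (cycleSetoid π) =>
      if p.1 then π p.2.out else p.2.out) := by
    have hq : ∀ p : Bool × Quotient (cycleSetoid π), Quotient.mk (cycleSetoid π)
        (if p.1 then π p.2.out else p.2.out) = p.2 := by
      rintro ⟨_ | _, q⟩
      · exact q.out_eq
      · exact hout q
    rintro ⟨b, q⟩ ⟨b', q'⟩ hb
    have h1 : q = q' :=
      (hq (b, q)).symm.trans ((congrArg (Quotient.mk (cycleSetoid π)) hb).trans (hq (b', q')))
    subst h1
    rcases b with _ | _ <;> rcases b' with _ | _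
    · rfl
    · exact absurd (Eq.symm hb) (hc _)
    · exact absurd hb (hc _)
    · rfl
  have h1 := Nat.card_le_card_of_injective _ hinj
  rw [Nat.card_prod, Nat.card_eq_fintype_card (α := Bool), Fintype.card_bool] at h1
  exact absurd h (not_lt.2 h1)

section

variable {S E : Type} {ρ : Perm S} {u : S → E}

theorem CyclicallyPlanar.of_map {E' : Type} {f : E → E'} (hf : Function.Injective f) {ℓ : List E}
    (h : CyclicallyPlanar ⊥ ρ (f ∘ u) (ℓ.map f)) : CyclicallyPlanar ⊥ ρ u ℓ := by
  rw [cyclicallyPlanar_iff (f ∘ ℓ.get) (by rw [← List.map_ofFn, List.ofFn_get])] at h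
  refine IsPlanarPartition.transport h (Equiv.refl _) (fun _ => rfl) ?_
  rintro (x | i) (y | j) <;> simp [hf.eq_iff]

theorem isRotated_rotate {α : Type} (l : List α) (n : ℕ) : l ~r l.rotate n := ⟨n, rfl⟩

/-- A planar system without internal edges has an isolated dangling edge, or two consecutive
dangling edges at the same vertex. -/
theorem CyclicallyPlanar.exists_reduction [IsEmpty S] {ℓ : List E}
    (h : CyclicallyPlanar ⊥ ρ u ℓ) (hℓ : 2 ≤ ℓ.length) :
    ∃ ℓ₀ x, (ℓ ~r ℓ₀ ++ [x] ∧ x ∉ ℓ₀) ∨ ℓ ~r ℓ₀ ++ [x, x] := by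
  obtain ⟨τ, hτ, hp⟩ := h
  rw [isPlanarRotation_iff] at hp
  have : Nonempty (Fin ℓ.length) := ⟨⟨0, by omega⟩⟩
  have h1 : numClasses (cycleSetoid (Perm.sumCongr ρ (finRotate ℓ.length))) = 1 := by
    rw [cycleSetoid_sumCongr, cycleSetoid_finRotate, numClasses_sumSetoid, numClasses_top,
      numClasses, Nat.card_of_isEmpty]
  have h2 : 0 < numClasses (orbitSetoid (Perm.sumCongr ρ (finRotate ℓ.length)) τ) := by
    have : Nonempty (Quotient (orbitSetoid (Perm.sumCongr ρ (finRotate ℓ.length)) τ)) :=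
      ⟨Quotient.mk _ (Sum.inr ⟨0, by omega⟩)⟩
    exact Nat.card_pos
  rw [h1] at hp
  have hrel : ∀ i j : Fin ℓ.length, cycleSetoid τ (Sum.inr i) (Sum.inr j) ↔ ℓ.get i = ℓ.get j := by
    intro i j
    rw [hτ]
    exact Iff.rfl
  -- With one cycle of `σ` and at least one component, vertices of `τ` and faces together outnumber
  -- the edges, so one of the two counts exceeds half of them. A fixed point of `τ` is an isolated
  -- dangling edge; a fixed point of the face permutation gives two neighbours at one vertex.
  obtain h3 | h3 : Nat.card (S ⊕ Fin ℓ.length) < 2 * numClasses (cycleSetoid τ) ∨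
      Nat.card (S ⊕ Fin ℓ.length) <
        2 * numClasses (cycleSetoid (τ * Perm.sumCongr ρ (finRotate ℓ.length))) := by omega
  · obtain ⟨x | i, hi⟩ := exists_fixed_of_card_lt h3
    · exact isEmptyElim x
    have hne : ∀ j : Fin ℓ.length, ℓ.get j = ℓ.get i → j = i := fun j hj =>
      Sum.inr_injective (Perm.SameCycle.eq_of_right ((hrel j i).2 hj) hi)
    refine ⟨(ℓ.rotate (i + 1)).dropLast, ℓ.get i, Or.inl ⟨?_, ?_⟩⟩
    · have h4 : ℓ.rotate (i + 1) ≠ [] := by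
        intro h
        rw [List.rotate_eq_nil_iff] at h
        simp [h] at hℓ
      have h5 : (ℓ.rotate (i + 1)).getLast h4 = ℓ.get i := by
        rw [List.getLast_eq_getElem, List.getElem_rotate]
        simp only [List.length_rotate, List.get_eq_getElem]
        congr 1
        have := i.isLt
        rw [show ℓ.length - 1 + (i + 1) = i + ℓ.length by omega, Nat.add_mod_right,
          Nat.mod_eq_of_lt this]
      rw [← h5, List.dropLast_append_getLast]
      exact isRotated_rotate _ _
    · intro hmem
      obtain ⟨k, hk, hk'⟩ := List.getElem_of_mem hmem
      rw [List.getElem_dropLast, List.getElem_rotate] at hk'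
      have h6 := congrArg Fin.val (hne ⟨(k + (i + 1)) % ℓ.length, _⟩ hk')
      simp only [List.length_dropLast, List.length_rotate] at hk
      have := i.isLt
      simp only at h6
      rcases lt_or_ge (k + (i + 1)) ℓ.length with h7 | h7
      · rw [Nat.mod_eq_of_lt h7] at h6
        omega
      · rw [Nat.mod_eq_sub_mod h7, Nat.mod_eq_of_lt (by omega)] at h6
        omega
  · obtain ⟨x | i, hi⟩ := exists_fixed_of_card_lt h3
    · exact isEmptyElim x
    have h4 : ℓ.get (finRotate ℓ.length i) = ℓ.get i := by
      rw [← hrel]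
      have h5 := cycleSetoid_apply (π := τ) (Sum.inr (finRotate ℓ.length i))
      have h6 : τ (Sum.inr (finRotate ℓ.length i)) = Sum.inr i := hi
      rwa [h6] at h5
    refine ⟨(ℓ.rotate (i + 2)).take (ℓ.length - 2), ℓ.get i, Or.inr ?_⟩
    have h5 : ℓ.rotate (i + 2)
        = (ℓ.rotate (i + 2)).take (ℓ.length - 2) ++ [ℓ.get i, ℓ.get i] := by
      have hi' := i.isLt
      refine List.ext_getElem (by simp; omega) fun k hk _ => ?_
      rw [List.length_rotate] at hk
      rw [List.getElem_append]
      split_ifs with h7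
      · rw [List.getElem_take]
      · simp only [List.length_take, List.length_rotate, not_lt] at h7
        rw [min_eq_left (by omega)] at h7
        simp only [List.length_take, List.length_rotate, min_eq_left (Nat.sub_le ℓ.length 2)]
        obtain rfl | rfl : k = ℓ.length - 2 ∨ k = ℓ.length - 1 := by omega
        · simp only [Nat.sub_self, List.getElem_cons_zero, List.getElem_rotate, List.get_eq_getElem]
          congr 1
          rw [show ℓ.length - 2 + (i + 2) = i + ℓ.length by omega, Nat.add_mod_right,
            Nat.mod_eq_of_lt hi']
        · simp only [show ℓ.length - 1 - (ℓ.length - 2) = 1 by omega, List.getElem_cons_succ,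
            List.getElem_cons_zero, List.getElem_rotate]
          rw [← h4, List.get_eq_getElem]
          congr 1
          rw [val_finRotate, show ℓ.length - 1 + (i + 2) = (i + 1) + ℓ.length by omega,
            Nat.add_mod_right]
          split_ifs with h8
          · rw [h8, Nat.mod_self]
          · rw [Nat.mod_eq_of_lt (by omega)]
    rw [← h5]
    exact isRotated_rotate _ _

end

end Gadget

/-! ### Planar gadgets without constraint vertices -/

namespace Generated

open Gadget

variable {q : ℕ} {𝓕 : Set (ConstraintFunction q)}

/-- A vertex that carries no edge except possibly the last dangling edges. -/
theorem of_isolated {D : Body q} [IsEmpty D.C] {x : D.E} [Nonempty {y // y ≠ x}]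
    {ℓ : List {y // y ≠ x}} (n : ℕ)
    (h : ∀ D' : Body q, ∀ e : D'.E ≃ {y // y ≠ x}, IsEmpty D'.C →
      Generated 𝓕 D' (ℓ.map e.symm) []) :
    Generated 𝓕 D (ℓ.map Subtype.val ++ List.replicate n x) [] := by
  classical
  have := D.finite_E
  let D' : Body q := ⟨{y // y ≠ x}, Empty, inferInstance, inferInstance, inferInstance,
    fun c => c.elim, fun c => c.elim⟩
  have h1 := h D' (Equiv.refl _) (inferInstanceAs (IsEmpty Empty))
  let e : {y // y ≠ x} ⊕ Unit ≃ D.E := Equiv.ofBijective (Sum.elim Subtype.val fun _ => x) (by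
    constructor
    · rintro (a | a) (b | b) hab
      · exact congrArg _ (Subtype.ext hab)
      · exact absurd hab a.2
      · exact absurd hab.symm b.2
      · rfl
    · intro y
      by_cases hy : y = x
      · exact ⟨Sum.inr (), hy.symm⟩
      · exact ⟨Sum.inl ⟨y, hy⟩, rfl⟩)
  refine (h1.tensor (Generated.single (List.replicate n ()) [])).iso (D' := D)
    ⟨e, Equiv.equivOfIsEmpty (Empty ⊕ Empty) D.C, ?_, ?_⟩ ?_ rfl
  · rintro (⟨⟨⟩⟩ | ⟨⟨⟩⟩)
  · rintro (⟨⟨⟩⟩ | ⟨⟨⟩⟩)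
  · simp only [List.map_append, List.map_map, List.map_replicate]
    rfl

/-- Induction on vertices plus dangling edges: a vertex with at most one dangling edge is split off
as a tensor factor, and otherwise one of two neighbouring edges at the same vertex is dropped. -/
theorem of_cyclicallyPlanar_of_isEmpty (D : Body q) [IsEmpty D.C] (ℓ : List D.E)
    (h : CyclicallyPlanar ⊥ (1 : Equiv.Perm Empty) Empty.elim ℓ) : Generated 𝓕 D ℓ [] := by
  induction hN : Nat.card D.E + ℓ.length using Nat.strong_induction_on generalizing D ℓ with
  | _ N ih =>
  have := D.finite_E
  have := D.nonempty_E
  have step : ∀ (x : D.E) (ℓ₀ : List D.E) (n : ℕ), x ∉ ℓ₀ → ℓ₀.length ≤ ℓ.length →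
      Nontrivial D.E → CyclicallyPlanar ⊥ (1 : Equiv.Perm Empty) Empty.elim ℓ₀ →
      Generated 𝓕 D (ℓ₀ ++ List.replicate n x) [] := by
    intro x ℓ₀ n hx hle hnt hp
    lift ℓ₀ to List {y // y ≠ x} using fun y hy => by rintro rfl; exact hx hy
    have : Nonempty {y // y ≠ x} := by
      obtain ⟨y, hy⟩ := exists_ne x
      exact ⟨⟨y, hy⟩⟩
    refine of_isolated n fun D' e hD' => ?_
    have hlt : Nat.card D'.E < Nat.card D.E := by
      rw [Nat.card_congr e]
      exact Finite.card_subtype_lt (x := x) (by simp)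
    refine ih _ ?_ D' _ ?_ rfl
    · simp only [List.length_map] at hle ⊢
      omega
    · refine CyclicallyPlanar.of_map (f := fun y => (e y).1)
        (Subtype.val_injective.comp e.injective) ?_
      convert hp using 1
      simp [Function.comp_def]
  rcases subsingleton_or_nontrivial D.E with hs | hnt
  · have x : D.E := Classical.arbitrary D.E
    have : Unique D.E := ⟨⟨x⟩, fun y => Subsingleton.elim y x⟩
    refine (Generated.single (List.replicate ℓ.length ()) []).iso (D' := D)
      ⟨Equiv.ofUnique Unit D.E, Equiv.equivOfIsEmpty Empty D.C, fun c => c.elim, fun c => c.elim⟩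
      (List.ext_getElem (by simp) fun _ _ _ => Subsingleton.elim _ _) rfl
  · by_cases hiso : ∃ x, x ∉ ℓ
    · obtain ⟨x, hx⟩ := hiso
      simpa using step x ℓ 0 hx le_rfl hnt h
    · push Not at hiso
      have hlen : 2 ≤ ℓ.length := by
        obtain ⟨x, y, hxy⟩ := exists_pair_ne D.E
        have hx := hiso x
        have hy := hiso y
        match ℓ, hx, hy with
        | [a], hx, hy =>
          exact absurd ((List.mem_singleton.1 hx).trans (List.mem_singleton.1 hy).symm) hxy
        | _ :: _ :: _, _, _ => simp
      obtain ⟨ℓ₀, x, ⟨hr, hx⟩ | hr⟩ := h.exists_reduction hlen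
      · have h1 := (h.of_isRotated hr).append_comm.tail
        have hl := hr.perm.length_eq
        exact (step x ℓ₀ 1 hx (by simp at hl; omega) hnt h1).of_isRotated hr.symm
      · have h1 : CyclicallyPlanar ⊥ (1 : Equiv.Perm Empty) Empty.elim (ℓ₀ ++ [x]) :=
          ((h.of_isRotated hr).append_comm.tail : CyclicallyPlanar _ _ _ ([x] ++ ℓ₀)).append_comm
        have hl := hr.perm.length_eq
        have h2 := ih _ (by simp at hl ⊢; omega) D (ℓ₀ ++ [x]) h1 rfl
        -- Attaching `E^{2,1}` doubles the remaining dangling edge at `x`, restoring the one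
        -- dropped.
        have h3 := (Generated.single (q := q) (𝓕 := 𝓕) [(), ()] [()]).attach h2 (fun _ => x)
          (fun _ => List.mem_singleton.2 rfl) rfl
        refine (h3.iso (D' := D) ⟨Equiv.refl _, Equiv.emptySum Empty D.C, ?_, ?_⟩
          (List.map_id _).symm rfl).of_isRotated hr.symm
        · rintro (⟨⟨⟩⟩ | c); rfl
        · rintro (⟨⟨⟩⟩ | c) _; rfl

end Generated


namespace Gadget

open Equiv

/-! ### Removing a constraint vertex -/

theorem isRotated_ofFn_finRotate {α : Type} {n : ℕ} (v : Fin n → α) :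
    List.ofFn v ~r List.ofFn (v ∘ finRotate n) := by
  refine ⟨1, List.ext_getElem (by simp) fun k h₁ h₂ => ?_⟩
  rw [List.getElem_rotate, List.getElem_ofFn, List.getElem_ofFn]
  simp only [List.length_ofFn, Function.comp_apply] at h₂ ⊢
  congr 1
  ext
  rw [val_finRotate]
  split_ifs with h
  · simp only at h ⊢
    rw [h, Nat.mod_self]
  · simp only at h ⊢
    rw [Nat.mod_eq_of_lt (by omega)]

theorem exists_rotation {n : ℕ} (j : Fin n) : ∃ g : Perm (Fin n),
    (∀ x, g (finRotate n x) = finRotate n (g x)) ∧ (g j : ℕ) + 1 = n ∧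
      List.ofFn g.symm ~r List.finRange n := by
  induction hk : n - 1 - j generalizing j with
  | zero =>
    exact ⟨1, fun _ => rfl, by simp; omega, List.IsRotated.refl _⟩
  | succ k ih =>
    obtain ⟨g, hg, hj, hr⟩ := ih (finRotate n j) (by rw [val_finRotate]; split_ifs <;> omega)
    refine ⟨(finRotate n).trans g, fun x => hg _, hj, ?_⟩
    have h1 := isRotated_ofFn_finRotate ((finRotate n).trans g).symm
    have h2 : ((finRotate n).trans g).symm ∘ finRotate n = g.symm := by
      funext x
      rw [Function.comp_apply, Equiv.symm_apply_eq, Equiv.trans_apply, hg, g.apply_symm_apply]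
    rw [h2] at h1
    exact h1.trans hr

/-- The relabelling `g` makes either orientation the standard rotation and puts `j` last, where
`finSumFinEquiv_swap` cuts the cycle; the order it produces is the original or the reversed one, up
to rotation. -/
theorem exists_orientedRotation (b : Bool) {n : ℕ} (j : Fin n) : ∃ g : Perm (Fin n),
    (∀ x, g (orientedRotation b n x) = finRotate n (g x)) ∧ (g j : ℕ) + 1 = n ∧
      (List.ofFn g.symm ~r List.finRange n ∨ List.ofFn g.symm ~r (List.finRange n).reverse) := by
  cases b with
  | true =>
    obtain ⟨g, hg, hj, hr⟩ := exists_rotation j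
    exact ⟨g, hg, hj, Or.inl hr⟩
  | false =>
    obtain ⟨g, hg, hj, hr⟩ := exists_rotation j.rev
    refine ⟨Fin.revPerm.trans g, fun x => ?_, hj, Or.inr ?_⟩
    · obtain ⟨x, rfl⟩ := (finRotate n).surjective x
      have h1 : orientedRotation false n (finRotate n x) = x := (finRotate n).symm_apply_apply x
      have h2 : x.rev = finRotate n (finRotate n x).rev := by
        ext
        have := x.isLt
        simp only [val_finRotate, Fin.val_rev]
        split_ifs <;> omega
      rw [h1]
      change g x.rev = finRotate n (g (finRotate n x).rev)
      rw [← hg, ← h2]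
    · have h1 : List.ofFn (Fin.revPerm.trans g).symm = (List.ofFn g.symm).map Fin.rev := by
        rw [List.map_ofFn]
        rfl
      rw [h1, List.finRange_reverse]
      exact hr.map _

theorem finSumFinEquiv_swap_of_last {m n : ℕ} {a : Fin m} {b : Fin n} (ha : (a : ℕ) + 1 = m)
    (hb : (b : ℕ) + 1 = n) (z : Fin m ⊕ Fin n) :
    finSumFinEquiv ((Perm.sumCongr (finRotate m) (finRotate n) *
        swap (Sum.inl a) (Sum.inr b)) z) = finRotate (m + n) (finSumFinEquiv z) := by
  obtain ⟨m, rfl⟩ := Nat.exists_eq_succ_of_ne_zero (by omega : m ≠ 0)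
  obtain ⟨n, rfl⟩ := Nat.exists_eq_succ_of_ne_zero (by omega : n ≠ 0)
  obtain rfl : a = Fin.last m := Fin.ext (by simpa using ha)
  obtain rfl : b = Fin.last n := Fin.ext (by simpa using hb)
  exact finSumFinEquiv_swap z

/-- Two vertices of the same part can be merged without leaving the sphere. -/
theorem IsPlanarPartition.exists_merge {S X : Type} [Finite S] [Finite X] [DecidableEq (S ⊕ X)]
    [Nonempty S] [Nonempty X] {ρ : Perm S} {π : Perm X} {s : Setoid (S ⊕ X)}
    (h : IsPlanarPartition (Perm.sumCongr ρ π) s) :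
    ∃ a b, IsPlanarPartition (Perm.sumCongr ρ π * swap (Sum.inl a) (Sum.inr b)) s := by
  obtain ⟨τ, hτ, hp⟩ := h
  have hab : ∀ a b, ¬cycleSetoid (Perm.sumCongr ρ π) (Sum.inl a) (Sum.inr b) := fun a b => by
    rw [cycleSetoid_sumCongr]
    simp
  suffices ∃ a b, cycleSetoid (τ * Perm.sumCongr ρ π) (Sum.inl a) (Sum.inr b) ∨
      ¬orbitSetoid (Perm.sumCongr ρ π) τ (Sum.inl a) (Sum.inr b) by
    obtain ⟨a, b, hf⟩ := this
    exact ⟨a, b, τ, hτ, hp.merge_left_mul (hab a b) hf⟩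
  -- If no face met both sides, `τ` could not send an edge of one side to the other, so the sides
  -- would be unions of components; yet the negation also puts all edges into one component.
  by_contra! hc
  have h1 : ∀ x, τ (Sum.inr x) ∈ Set.range (Sum.inr : X → S ⊕ X) := by
    intro x
    obtain ⟨x, rfl⟩ := π.surjective x
    rcases hx : τ (Sum.inr (π x)) with a | b
    · refine absurd ?_ (hc a x).1
      have h2 := cycleSetoid_apply (π := τ * Perm.sumCongr ρ π) (Sum.inr x)
      have h3 : (τ * Perm.sumCongr ρ π) (Sum.inr x) = Sum.inl a := hx
      rw [h3] at h2
      exact Setoid.symm' _ h2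
    · exact ⟨b, rfl⟩
  have h2 : Set.MapsTo τ (Set.range (Sum.inl : S → S ⊕ X)) (Set.range Sum.inl) := by
    rw [Perm.perm_mapsTo_inl_iff_mapsTo_inr]
    rintro _ ⟨x, rfl⟩
    exact h1 x
  have h3 : orbitSetoid (Perm.sumCongr ρ π) τ ≤ Setoid.ker Sum.isRight := by
    refine sup_le (cycleSetoid_le ?_) (cycleSetoid_le ?_)
    · rintro (x | x) <;> rfl
    · rintro (x | x)
      · obtain ⟨y, hy⟩ := h2 ⟨x, rfl⟩
        rw [← hy]
        rfl
      · obtain ⟨y, hy⟩ := h1 x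
        rw [← hy]
        rfl
  obtain ⟨a⟩ := ‹Nonempty S›
  obtain ⟨b⟩ := ‹Nonempty X›
  have := h3 (hc a b).2
  simp [Setoid.ker_def] at this

section

variable {q : ℕ} {C E : Type} {sig : C → ConstraintFunction q}
  {inc : (c : C) → Fin (sig c).arity → E} {o : C → Bool}

/-- By `h₂`, the rotation `π` runs cyclically through the old dangling edges and then the edges at
`c`; reading this one cycle as infinity is a mere relabelling of edges. -/
theorem cyclicallyPlanar_of_remove (c : C) {n : ℕ} {v : Fin n → E} (e : Perm (Fin n))
    (g : Perm (Fin (sig c).arity)) {π : Perm ((Σ c, Fin (sig c).arity) ⊕ Fin n)}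
    (h : IsPlanarPartition π (Setoid.comap (Sum.elim (fun x => inc x.1 x.2) v) ⊥))
    (h₁ : ∀ c', c' ≠ c → ∀ i, π (Sum.inl ⟨c', i⟩) = Sum.inl (vertexRotation sig o ⟨c', i⟩))
    (h₂ : ∀ z, π (Sum.elim (Sum.inr ∘ e.symm) (fun y => Sum.inl ⟨c, g.symm y⟩)
        (finSumFinEquiv.symm z)) = Sum.elim (Sum.inr ∘ e.symm) (fun y => Sum.inl ⟨c, g.symm y⟩)
        (finSumFinEquiv.symm (finRotate _ z))) :
    CyclicallyPlanar ⊥ (vertexRotation (fun c' : {x // x ≠ c} => sig c') fun c' => o c')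
      (fun x => inc x.1 x.2) (List.ofFn (v ∘ e.symm) ++ (List.ofFn g.symm).map (inc c)) := by
  rw [cyclicallyPlanar_iff (Fin.append (v ∘ e.symm) (inc c ∘ g.symm))
    (by rw [List.ofFn_fin_append, List.map_ofFn])]
  let φ : (Σ c' : {x // x ≠ c}, Fin (sig c').arity) ⊕ Fin (n + (sig c).arity) ≃
      (Σ c, Fin (sig c).arity) ⊕ Fin n :=
    Equiv.ofBijective (Sum.elim (fun x => Sum.inl ⟨x.1, x.2⟩) fun z =>
      Sum.elim (Sum.inr ∘ e.symm) (fun y => Sum.inl ⟨c, g.symm y⟩) (finSumFinEquiv.symm z)) (by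
    constructor
    · rintro (⟨⟨c₁, hc₁⟩, i⟩ | z) (⟨⟨c₂, hc₂⟩, j⟩ | z') hxy
      · simpa using hxy
      · obtain ⟨z', rfl⟩ := finSumFinEquiv.surjective z'
        rcases z' with z' | z'
        · simp at hxy
        · simp only [Sum.elim_inl, Sum.elim_inr, Equiv.symm_apply_apply, Sum.inl.injEq,
            Sigma.mk.injEq] at hxy
          exact absurd hxy.1 hc₁
      · obtain ⟨z, rfl⟩ := finSumFinEquiv.surjective z
        rcases z with z | z
        · simp at hxy
        · simp only [Sum.elim_inl, Sum.elim_inr, Equiv.symm_apply_apply, Sum.inl.injEq,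
            Sigma.mk.injEq] at hxy
          exact absurd hxy.1.symm hc₂
      · obtain ⟨z, rfl⟩ := finSumFinEquiv.surjective z
        obtain ⟨z', rfl⟩ := finSumFinEquiv.surjective z'
        rcases z with z | z <;> rcases z' with z' | z' <;> simp at hxy ⊢ <;> exact hxy
    · rintro (⟨c', i⟩ | j)
      · by_cases hc : c' = c
        · subst hc
          exact ⟨Sum.inr (finSumFinEquiv (Sum.inr (g i))), by simp⟩
        · exact ⟨Sum.inl ⟨⟨c', hc⟩, i⟩, rfl⟩
      · exact ⟨Sum.inr (finSumFinEquiv (Sum.inl (e j))), by simp⟩)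
  refine h.transport φ.symm (fun x => ?_) (fun x y => ?_)
  · obtain ⟨x, rfl⟩ := φ.surjective x
    rw [Equiv.symm_apply_eq, Equiv.symm_apply_apply]
    rcases x with ⟨⟨c', hc'⟩, i⟩ | z
    · exact h₁ c' hc' i
    · exact h₂ z
  · have h3 : ∀ x, Sum.elim (fun x : Σ c, Fin (sig c).arity => inc x.1 x.2) v (φ x)
        = Sum.elim (fun x : Σ c' : {x // x ≠ c}, Fin (sig c').arity => inc x.1 x.2)
          (Fin.append (v ∘ e.symm) (inc c ∘ g.symm)) x := by
      rintro (x | z)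
      · rfl
      · obtain ⟨z, rfl⟩ := finSumFinEquiv.surjective z
        have h4 : φ (Sum.inr (finSumFinEquiv z)) = Sum.elim (Sum.inr ∘ e.symm)
            (fun y => Sum.inl ⟨c, g.symm y⟩) z := by
          conv_rhs => rw [← finSumFinEquiv.symm_apply_apply z]
          rfl
        rw [h4]
        rcases z with z | z <;> simp
    obtain ⟨x, rfl⟩ := φ.surjective x
    obtain ⟨y, rfl⟩ := φ.surjective y
    rw [Equiv.symm_apply_apply, Equiv.symm_apply_apply, Setoid.comap_rel, Setoid.comap_rel, h3, h3]
    rfl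

theorem CyclicallyPlanar.exists_remove [Finite C] [Nonempty C] {ℓ : List E}
    (h : CyclicallyPlanar ⊥ (vertexRotation sig o) (fun x => inc x.1 x.2) ℓ) :
    ∃ (c : C) (ℓ' : List E) (A : List (Fin (sig c).arity)), ℓ ~r ℓ' ∧
      (A ~r List.finRange _ ∨ A ~r (List.finRange _).reverse) ∧
      CyclicallyPlanar ⊥ (vertexRotation (fun c' : {x // x ≠ c} => sig c') fun c' => o c')
        (fun x => inc x.1 x.2) (ℓ' ++ A.map (inc c)) := by
  classical
  -- Without dangling edges infinity is not a vertex of the rotation system, and any constraint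
  -- vertex can take its place. Otherwise one has to be chosen that can be merged with infinity.
  by_cases hℓ : ℓ.length = 0
  · obtain ⟨c⟩ := ‹Nonempty C›
    obtain ⟨g, hg, -, hr⟩ := exists_orientedRotation (o c) (⟨0, (sig c).arity_pos⟩ : Fin _)
    refine ⟨c, _, _, List.IsRotated.refl _, hr, ?_⟩
    have h3 := cyclicallyPlanar_of_remove (o := o) c 1 g h (fun _ _ _ => rfl) ?_
    · convert h3 using 2
      exact (List.ofFn_get ℓ).symm
    · intro z
      obtain ⟨z, rfl⟩ := finSumFinEquiv.surjective z
      rw [← finSumFinEquiv_sumCongr (Or.inl hℓ), Equiv.symm_apply_apply, Equiv.symm_apply_apply]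
      rcases z with z | z
      · rfl
      · have h4 := hg (g.symm z)
        rw [g.apply_symm_apply, ← Equiv.eq_symm_apply] at h4
        simp [vertexRotation_apply, h4]
  · have : Nonempty (Fin ℓ.length) := ⟨⟨0, by omega⟩⟩
    have : Nonempty (Σ c, Fin (sig c).arity) := by
      obtain ⟨c⟩ := ‹Nonempty C›
      exact ⟨⟨c, 0, (sig c).arity_pos⟩⟩
    obtain ⟨⟨c, i⟩, j, h1⟩ := IsPlanarPartition.exists_merge h
    obtain ⟨g, hg, hi, hr⟩ := exists_orientedRotation (o c) i
    obtain ⟨e, he, hj, hr'⟩ := exists_rotation j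
    refine ⟨c, _, _, ?_, hr, cyclicallyPlanar_of_remove (o := o) c e g h1 ?_ ?_⟩
    · have := (hr'.map ℓ.get).symm
      rw [List.map_ofFn, ← List.ofFn_eq_map, List.ofFn_get] at this
      exact this
    · intro c' hc' k
      rw [Perm.mul_apply, swap_apply_of_ne_of_ne (by simp [hc']) (by simp)]
      rfl
    · intro z
      obtain ⟨z, rfl⟩ := finSumFinEquiv.surjective z
      rw [← finSumFinEquiv_swap_of_last hj hi, Equiv.symm_apply_apply, Equiv.symm_apply_apply]
      set ψ : Fin ℓ.length ⊕ Fin (sig c).arity → (Σ c, Fin (sig c).arity) ⊕ Fin ℓ.length :=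
        Sum.elim (Sum.inr ∘ e.symm) (fun y => Sum.inl ⟨c, g.symm y⟩) with hψ
      have hinj : Function.Injective ψ := by
        rintro (x | x) (y | y) hxy <;> simp [hψ] at hxy ⊢ <;> exact hxy
      have h3 : ∀ z, ψ (Perm.sumCongr (finRotate _) (finRotate _) z)
          = Perm.sumCongr (vertexRotation sig o) (finRotate _) (ψ z) := by
        rintro (z | z)
        · have h4 := he (e.symm z)
          rw [e.apply_symm_apply, ← Equiv.eq_symm_apply] at h4
          simp [hψ, h4]
        · have h4 := hg (g.symm z)
          rw [g.apply_symm_apply, ← Equiv.eq_symm_apply] at h4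
          simp [hψ, vertexRotation_apply, h4]
      rw [Perm.mul_apply, Perm.mul_apply, h3, hinj.map_swap]
      have h5 : ψ (Sum.inl (e j)) = Sum.inr j := by simp [hψ]
      have h6 : ψ (Sum.inr (g i)) = Sum.inl ⟨c, i⟩ := by simp [hψ]
      rw [h5, h6, swap_comm]

end

end Gadget

/-! ### Induction on the number of constraint vertices -/

namespace Generated

open Gadget

variable {q : ℕ} {𝓕 : Set (ConstraintFunction q)}

/-- One constraint vertex, each of whose edges ends at its own equality vertex. -/
abbrev sigBody (F : ConstraintFunction q) : Body q where
  E := Fin F.arity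
  C := Unit
  finite_E := inferInstance
  finite_C := inferInstance
  nonempty_E := ⟨⟨0, F.arity_pos⟩⟩
  sig := fun _ => F
  inc := fun _ i => i

theorem sigBody_finRange {F : ConstraintFunction q} (hF : F ∈ 𝓕) :
    Generated 𝓕 (sigBody F) (List.finRange F.arity) [] :=
  (iff_inClosure (D := sigBody F) id (fun j : Fin 0 => j.elim0) (List.ofFn_id _).symm rfl).2
    (InClosure.iso (K := sigGadget F)
      ⟨Equiv.refl _, Equiv.refl _, fun _ => rfl, fun _ _ => rfl, fun _ => rfl, fun j => j.elim0⟩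
      (InClosure.of (IsGenerator.sig F hF)))

/-- The dagger of the generator for `F.conj` carries `F` with inputs in the original order, and
bending these into outputs reverses the order. -/
theorem sigBody_finRange_reverse (h𝓕 : ConjugateClosed 𝓕) {F : ConstraintFunction q}
    (hF : F ∈ 𝓕) : Generated 𝓕 (sigBody F) (List.finRange F.arity).reverse [] := by
  have h1 : Generated 𝓕 (sigBody F) [] (List.finRange F.arity) :=
    (sigBody_finRange ((h𝓕 F).1 hF)).dagger.iso (D' := sigBody F)
      ⟨Equiv.refl _, Equiv.refl _, fun _ => (conj_conj F).symm, fun _ _ => rfl⟩ rfl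
      (List.map_id _).symm
  exact unbend_append (o := []) (i := []) h1

/-- All planar ways to use the edges of a constraint vertex as inputs. -/
theorem sigBody_of_isRotated (h𝓕 : ConjugateClosed 𝓕) {F : ConstraintFunction q} (hF : F ∈ 𝓕)
    {A : List (Fin F.arity)} (hA : A ~r List.finRange _ ∨ A ~r (List.finRange _).reverse) :
    Generated 𝓕 (sigBody F) [] A := by
  have h1 : Generated 𝓕 (sigBody F) A.reverse [] := by
    rcases hA with hA | hA
    · exact (sigBody_finRange_reverse h𝓕 hF).of_isRotated hA.symm.reverse
    · refine (sigBody_finRange hF).of_isRotated ?_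
      simpa using hA.symm.reverse
  simpa using bend_append (o := []) (i := []) h1

theorem of_cyclicallyPlanar (h𝓕 : ConjugateClosed 𝓕) (D : Body q) (hD : ∀ c, D.sig c ∈ 𝓕)
    (o : D.C → Bool) (ℓ : List D.E)
    (h : CyclicallyPlanar ⊥ (vertexRotation D.sig o) (fun x => D.inc x.1 x.2) ℓ) :
    Generated 𝓕 D ℓ [] := by
  induction hN : Nat.card D.C generalizing D with
  | zero =>
    have := D.finite_C
    have : IsEmpty D.C := Finite.card_eq_zero_iff.1 hN
    refine of_cyclicallyPlanar_of_isEmpty D ℓ ?_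
    have h1 := h.map_bot (ρ' := (1 : Equiv.Perm Empty)) (u' := Empty.elim) (Equiv.equivOfIsEmpty _ _)
      (fun x => isEmptyElim x.1) id (fun _ _ => Iff.rfl) (fun x => (IsEmpty.false x.1).elim)
    rwa [List.map_id] at h1
  | succ N ih =>
    classical
    have := D.finite_C
    have := D.finite_E
    have := D.nonempty_E
    have : Nonempty D.C := (Nat.card_pos_iff.1 (by omega)).1
    obtain ⟨c, ℓ', A, hr, hA, h1⟩ := h.exists_remove
    let D' : Body q := ⟨D.E, {x // x ≠ c}, inferInstance, inferInstance, inferInstance,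
      fun x => D.sig x, fun x => D.inc x⟩
    have hcard : Nat.card D'.C = N := by
      have := Nat.card_congr (Equiv.optionSubtypeNe c)
      rw [Finite.card_option, hN] at this
      exact Nat.succ_injective this
    have h2 := ih D' (fun x => hD x) (fun x => o x) _ h1 hcard
    have hmem : ∀ x, x ∈ A := fun x => by
      rcases hA with hA | hA
      · exact hA.mem_iff.2 (List.mem_finRange x)
      · exact hA.mem_iff.2 (List.mem_reverse.2 (List.mem_finRange x))
    -- The vertex `c` is put back: its edges, as inputs in the order `A`, meet the dangling edges
    -- that its removal had created.
    have h3 := (sigBody_of_isRotated h𝓕 (hD c) hA).attach h2 (D.inc c) hmem rfl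
    let e : Unit ⊕ {x // x ≠ c} ≃ D.C :=
      (Equiv.sumComm _ _).trans ((Equiv.optionEquivSumPUnit _).symm.trans (Equiv.optionSubtypeNe c))
    refine (h3.iso (D' := D) ⟨Equiv.refl _, e, ?_, ?_⟩ ?_ rfl).of_isRotated hr.symm
    · rintro (x | x) <;> rfl
    · rintro (x | x) i <;> rfl
    · simp

theorem inClosure_of_isPlanar (h𝓕 : ConjugateClosed 𝓕) {m d : ℕ} {K : Gadget q m d}
    (hK : ∀ c, K.sig c ∈ 𝓕) (h : K.IsPlanar) : InClosure (generators 𝓕) m d K := by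
  rw [isPlanar_iff] at h
  obtain ⟨o, h⟩ := h
  let D : Body q := ⟨K.E, K.C, K.finite_E, K.finite_C, K.nonempty_E, K.sig, K.inc⟩
  -- The whole boundary is generated as outputs; bending the part formed by the reversed inputs of
  -- `K` restores them as inputs in their proper order.
  have h1 := bend_append (of_cyclicallyPlanar h𝓕 D hK o K.boundary h)
  rw [List.nil_append, List.reverse_reverse] at h1
  exact (iff_inClosure (D := D) K.out K.inp rfl rfl).1 h1

end Generated

theorem mainTheorem3 (q : ℕ) (hq : 1 ≤ q) (𝓕 : Set (ConstraintFunction q))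
    (h𝓕 : ConjugateClosed 𝓕) :
    planarGadgets 𝓕 = gadgetClosure (generators 𝓕) := by
  funext m d
  exact Set.ext fun K => ⟨fun h => Generated.inClosure_of_isPlanar h𝓕 h.1 h.2,
    fun h => Gadget.mem_planarGadgets_of_inClosure h𝓕 h⟩
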